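/- Let $p\in(0,1)$. For $N=1,2,\dots$ put $L=2N-1$. The $N$-particle Krawtchouk ensemble is the random $N$-point configuration $\{x_1,\dots,x_N\}\subset\{0,1,\dots,L\}$ with $$\operatorname{Prob}(\{x_1,\dots,x_N\})=\mathrm{const}(p,N)\cdot\prod_{i=1}^N\binom{L}{x_i}p^{x_i}(1-p)^{L-x_i}\prod_{1\le i<j\le N}(x_i-x_j)^2,$$ where $\mathrm{const}(p,N)$ is the normalization constant making this a probability distribution. Fix a real number $c$ with $|c|<2\sqrt{p(1-p)}$, and let $(a_N)$ be any sequence of integers with $a_N/N\to c$ as $N\to\infty$. Shift the configuration to the left by $N+a_N$, that is, consider the random configuration $\{x_1',\dots,x_N'\}\subset\mathbb Z$ with $x_i'=x_i-N-a_N$. Put $$\varphi=\arccos\left(\frac{c(1-2p)}{2\sqrt{(1-c^2)\,p(1-p)}}\right).$$ Then there is exactly one probability measure $\mathcal P$ on the compact space $2^{\mathbb Z}$ of all subsets of $\mathbb Z$ (with the product topology) that is a determinantal point process with the discrete sine kernel $$K_\varphi(x,y)=\frac{\sin(\varphi(x-y))}{\pi(x-y)}\quad(x\ne y),\qquad K_\varphi(x,x)=\frac{\varphi}{\pi},$$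 i.e. the probability that the random subset contains $\{y_1,\dots,y_n\}$ equals $\det[K_\varphi(y_i,y_j)]_{i,j=1}^n$ for all $n$ and all pairwise distinct $y_1,\dots,y_n\in\mathbb Z$. The measure $\mathcal P$ is invariant under translations of $\mathbb Z$, and as $N\to\infty$ the distribution of $\{x_1',\dots,x_N'\}$, viewed as a probability measure on $2^{\mathbb Z}$, converges weakly to $\mathcal P$. -/

import Mathlib

open MeasureTheory Filter Topology

noncomputable section

/-! ### Random point processes on a discrete space -/

/-- The space `2^X` of all point configurations (subsets) of a discrete space `X`, as the product
`X → Bool`: the node `x` is occupied in `C` when `C x = true`. It carries the (compact) product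
topology and the product (= Borel, for countable `X`) sigma-algebra. -/
abbrev Conf (X : Type*) : Type _ := X → Bool

/-- The correlation functions of a random point process `P`:
`ρ_n(x_1, …, x_n) = Prob {the random configuration contains x_1, …, x_n}`. -/
def correlation {X : Type*} (P : ProbabilityMeasure (Conf X)) {n : ℕ} (x : Fin n → X) : ℝ :=
  (P : Measure (Conf X)).real {C | ∀ i, C (x i) = true}

/-- `P` is determinantal with correlation kernel `K`: for all finite sets `{x_1, …, x_n}` of
(distinct) points, `ρ_n(x_1, …, x_n) = det [K(x_i, x_j)]`. -/
def IsDeterminantal {X : Type*} (P : ProbabilityMeasure (Conf X)) (K : X → X → ℝ) : Prop :=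
  ∀ (n : ℕ) (x : Fin n → X), Function.Injective x →
    correlation P x = (Matrix.of fun i j => K (x i) (x j)).det

/-- Shift of a configuration on `ℤ` by `k` to the left: its points are `x - k`, where `x` ranges
over the points of `C`. -/
def shiftLeft (k : ℤ) (C : Conf ℤ) : Conf ℤ := fun y => C (y + k)

theorem measurable_shiftLeft (k : ℤ) : Measurable (shiftLeft k) :=
  measurable_pi_lambda _ fun y => measurable_pi_apply (y + k)

/-- The law of the process `P` shifted by `k` to the left. -/
def shiftProcess (k : ℤ) (P : ProbabilityMeasure (Conf ℤ)) : ProbabilityMeasure (Conf ℤ) :=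
  P.map (measurable_shiftLeft k).aemeasurable

def IsTranslationInvariant (P : ProbabilityMeasure (Conf ℤ)) : Prop :=
  ∀ k : ℤ, shiftProcess k P = P

/-- The discrete sine kernel `sin (φ (x - y)) / (π (x - y))`, equal to `φ / π` on the diagonal. -/
def discreteSineKernel (φ : ℝ) (x y : ℤ) : ℝ :=
  if x = y then φ / Real.pi
  else Real.sin (φ * ((x : ℝ) - y)) / (Real.pi * ((x : ℝ) - y))

/-! ### The Krawtchouk orthogonal polynomial ensemble -/

/-- The weight function of the Krawtchouk polynomials on `{0, 1, …, L}`. -/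
def krawtchoukWeight (p : ℝ) (L x : ℕ) : ℝ :=
  (L.choose x : ℝ) * p ^ x * (1 - p) ^ (L - x)

/-- The unnormalized probability `∏_i W(x_i) ∏_{i < j} (x_i - x_j)^2` of the configuration
`S = {x_1, …, x_N}`. -/
def krawtchoukEnsembleWeight (p : ℝ) (L : ℕ) (S : Finset ℕ) : ℝ :=
  (∏ x ∈ S, krawtchoukWeight p L x) *
    ∏ x ∈ S, ∏ y ∈ S with x < y, ((x : ℝ) - (y : ℝ)) ^ 2

/-- The `N`-particle configurations in `{0, 1, …, L}`. -/
def particleConfs (L N : ℕ) : Finset (Finset ℕ) :=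
  Finset.powersetCard N (Finset.range (L + 1))

/-- The probability of `S` in the `N`-particle Krawtchouk ensemble on `{0, 1, …, L}`. -/
def krawtchoukEnsembleProb (p : ℝ) (L N : ℕ) (S : Finset ℕ) : ℝ :=
  krawtchoukEnsembleWeight p L S / ∑ T ∈ particleConfs L N, krawtchoukEnsembleWeight p L T

/-- A finite set of nonnegative integers as a configuration on `ℤ`. -/
def toConf (S : Finset ℕ) : Conf ℤ := fun x => decide (∃ s ∈ S, (s : ℤ) = x)

/-- The law, on configurations on `ℤ`, of the `N`-particle Krawtchouk ensemble. -/
def krawtchoukMeasure (p : ℝ) (L N : ℕ) : Measure (Conf ℤ) :=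
  ∑ S ∈ particleConfs L N, ENNReal.ofReal (krawtchoukEnsembleProb p L N S) •
    Measure.dirac (toConf S)

theorem krawtchoukEnsembleWeight_pos {p : ℝ} (hp0 : 0 < p) (hp1 : p < 1) {L N : ℕ}
    {S : Finset ℕ} (hS : S ∈ particleConfs L N) : 0 < krawtchoukEnsembleWeight p L S := by
  have hS' := (Finset.mem_powersetCard.1 hS).1
  refine mul_pos (Finset.prod_pos fun x hx => ?_)
    (Finset.prod_pos fun x _ => Finset.prod_pos fun y hy => ?_)
  · have hx' : x ≤ L := Nat.lt_succ_iff.1 (Finset.mem_range.1 (hS' hx))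
    have h1 : (0 : ℝ) < L.choose x := by exact_mod_cast Nat.choose_pos hx'
    have h2 : 0 < 1 - p := by linarith
    unfold krawtchoukWeight
    positivity
  · have h : (x : ℝ) < y := by exact_mod_cast (Finset.mem_filter.1 hy).2
    have h' : (x : ℝ) - y ≠ 0 := sub_ne_zero.2 h.ne
    positivity

theorem krawtchoukMeasure_isProbabilityMeasure {p : ℝ} (hp0 : 0 < p) (hp1 : p < 1) {L N : ℕ}
    (hN : N ≤ L + 1) : IsProbabilityMeasure (krawtchoukMeasure p L N) := by
  have hpos : ∀ S ∈ particleConfs L N, 0 < krawtchoukEnsembleWeight p L S :=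
    fun S hS => krawtchoukEnsembleWeight_pos hp0 hp1 hS
  have hne : (particleConfs L N).Nonempty :=
    Finset.powersetCard_nonempty.2 (by simpa using hN)
  have hZ := Finset.sum_pos hpos hne
  refine ⟨?_⟩
  simp only [krawtchoukMeasure, Measure.coe_finsetSum, Finset.sum_apply, Measure.smul_apply,
    measure_univ, smul_eq_mul, mul_one]
  have hnn : ∀ S ∈ particleConfs L N, 0 ≤ krawtchoukEnsembleProb p L N S :=
    fun S hS => div_nonneg (hpos S hS).le hZ.le
  rw [← ENNReal.ofReal_sum_of_nonneg hnn]
  simp only [krawtchoukEnsembleProb]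
  rw [← Finset.sum_div, div_self hZ.ne', ENNReal.ofReal_one]

/-- The `N`-particle Krawtchouk ensemble on `{0, 1, …, L}`, as a random point process on `ℤ`. -/
def krawtchoukEnsemble (p : ℝ) (hp : p ∈ Set.Ioo (0 : ℝ) 1) (L N : ℕ) (hN : N ≤ L + 1) :
    ProbabilityMeasure (Conf ℤ) :=
  ⟨krawtchoukMeasure p L N, krawtchoukMeasure_isProbabilityMeasure hp.1 hp.2 hN⟩

/-- The number of particles is admissible for `L = 2 N - 1`. -/
theorem le_two_mul_sub_one_add_one (N : ℕ) : N ≤ (2 * N - 1) + 1 := by omega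

end

/-!
# Bulk limit of the Krawtchouk ensemble

The weight `∏ W(x_i) ∏ (x_i - x_j)²` is the squared determinant of the functions `√W · P_n`,
`n < N`, for any monic polynomials `P_n` of degree `n`. Taking the Krawtchouk polynomials makes
these functions orthogonal, and the ensemble is determinantal with the kernel of the orthogonal
projection onto their span (`correlation_krawtchoukEnsemble`, deduced from Andréief's identity
`sum_det_mul_det` by a generating function).

The asymptotics of this kernel need no asymptotics of the polynomials. The functions `√W · P_n` are
eigenfunctions, with the eigenvalues `L / 2 - n`, of an explicit symmetric tridiagonal operator
(`jacobi_krawtchoukFun`), so that for `L = 2 N - 1` the kernel is the spectral projection of that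
operator onto `(0, ∞)`. Divided by `N` and viewed from the site `N + a_N`, the operator has entries
converging to those of the translation-invariant tridiagonal operator with `√((1 - c²) p (1 - p))`
off the diagonal and `-(1 - 2p) c` on it (`jacobiApprox_krawtchouk`). Entries of powers of
tridiagonal operators are finite sums, so all moments converge; by polynomial approximation, and
because the limit operator has no eigenvalue at `0`, the spectral projections converge too
(`JacobiApprox.tendsto_spectralProjection`). In the Fourier picture the limit operator is the
multiplication by `2 A cos θ + B`, positive exactly for `|θ| < φ`, and its positive projection is
the discrete sine kernel (`toeplitzEntry_posInd`).

Hence the correlation functions converge to the minors of the sine kernel. Since the space of laws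
on the compact space `2^ℤ` is compact and a law is determined by its correlation functions, the
limit law exists, is unique, and is approached weakly
(`exists_isDeterminantal_of_tendsto_correlation`).
-/

noncomputable section

open Polynomial

/-! ### Point processes and their correlation functions -/

theorem isClopen_forall_eq_true {X : Type*} {n : ℕ} (x : Fin n → X) :
    IsClopen {C : Conf X | ∀ i, C (x i) = true} := by
  simp only [Set.ofPred_forall]
  exact isClopen_iInter_of_finite fun i =>
    (isClopen_discrete {true}).preimage (continuous_apply (x i))

theorem measurableSet_forall_eq_true {X : Type*} {n : ℕ} (x : Fin n → X) :
    MeasurableSet {C : Conf X | ∀ i, C (x i) = true} := by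
  simp only [Set.ofPred_forall]
  exact MeasurableSet.iInter fun i =>
    (measurable_pi_apply (x i) : Measurable fun C : Conf X => C (x i)) (measurableSet_singleton true)

theorem continuous_correlation {X : Type*} [Countable X] {n : ℕ} (x : Fin n → X) :
    Continuous fun P : ProbabilityMeasure (Conf X) => correlation P x := by
  refine continuous_iff_continuousAt.2 fun P => ?_
  have h := ProbabilityMeasure.tendsto_measure_of_null_frontier_of_tendsto'
    (tendsto_id (α := ProbabilityMeasure (Conf X)) (x := 𝓝 P))
    (E := {C : Conf X | ∀ i, C (x i) = true}) (by
      rw [(isClopen_forall_eq_true x).frontier_eq]; simp)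
  exact (ENNReal.tendsto_toReal (measure_ne_top _ _)).comp h

/-- The events `{C | s ⊆ C}`, `s` finite, form a π-system generating the σ-algebra. -/
theorem IsDeterminantal.unique {X : Type*} {K : X → X → ℝ}
    {P Q : ProbabilityMeasure (Conf X)} (hP : IsDeterminantal P K) (hQ : IsDeterminantal Q K) :
    Q = P := by
  classical
  let 𝒞 : Set (Set (Conf X)) := Set.range fun s : Finset X => {C | ∀ x ∈ s, C x = true}
  have hgen : (MeasurableSpace.pi : MeasurableSpace (Conf X)) = MeasurableSpace.generateFrom 𝒞 := by
    refine le_antisymm (iSup_le fun x => ?_) (MeasurableSpace.generateFrom_le ?_)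
    · rw [← measurable_iff_comap_le]
      refine measurable_to_bool (MeasurableSpace.measurableSet_generateFrom ⟨{x}, ?_⟩)
      ext C
      simp
    · rintro _ ⟨s, rfl⟩
      simp only [Set.ofPred_forall]
      exact MeasurableSet.biInter s.countable_toSet fun x _ =>
        (measurable_pi_apply x : Measurable fun C : Conf X => C x) (measurableSet_singleton true)
  have hpi : IsPiSystem 𝒞 := by
    rintro _ ⟨s, rfl⟩ _ ⟨t, rfl⟩ -
    refine ⟨s ∪ t, ?_⟩
    ext C
    simp only [Finset.mem_union, Set.mem_ofPred_eq, Set.mem_inter_iff]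
    exact ⟨fun h => ⟨fun x hx => h x (.inl hx), fun x hx => h x (.inr hx)⟩,
      fun h x hx => hx.elim (h.1 x) (h.2 x)⟩
  refine Subtype.ext (ext_of_generate_finite (μ := (Q : Measure (Conf X))) 𝒞 hgen hpi ?_ (by simp))
  rintro _ ⟨s, rfl⟩
  let x : Fin s.card → X := fun i => s.equivFin.symm i
  have hx : Function.Injective x := Subtype.val_injective.comp s.equivFin.symm.injective
  have hset : {C : Conf X | ∀ y ∈ s, C y = true} = {C | ∀ i, C (x i) = true} := by
    ext C
    refine ⟨fun h i => h _ (s.equivFin.symm i).2, fun h y hy => ?_⟩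
    simpa [x] using h (s.equivFin ⟨y, hy⟩)
  have h := (hQ _ x hx).trans (hP _ x hx).symm
  simp only [correlation, ← hset] at h
  exact (measureReal_eq_measureReal_iff (measure_ne_top (Q : Measure (Conf X)) _)
    (measure_ne_top (P : Measure (Conf X)) _)).1 h

/-- By compactness of the space of laws on `2^X`, pointwise convergence of the correlation
functions to the minors of a kernel produces the determinantal process and the weak convergence
to it at once: every cluster point is determinantal, and there is only one such process. -/
theorem exists_isDeterminantal_of_tendsto_correlation {X : Type*} [Countable X] {K : X → X → ℝ}
    {P : ℕ → ProbabilityMeasure (Conf X)}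
    (h : ∀ (n : ℕ) (x : Fin n → X), Function.Injective x →
      Tendsto (fun k => correlation (P k) x) atTop
        (𝓝 (Matrix.of fun i j => K (x i) (x j)).det)) :
    ∃ Q : ProbabilityMeasure (Conf X), IsDeterminantal Q K ∧ Tendsto P atTop (𝓝 Q) := by
  have hcluster : ∀ Q, MapClusterPt Q atTop P → IsDeterminantal Q K := fun Q hQ n x hx => by
    have h1 : MapClusterPt (correlation Q x) atTop (fun k => correlation (P k) x) :=
      hQ.continuousAt_comp (continuous_correlation x).continuousAt
    exact eq_of_nhds_neBot (h1.clusterPt.mono (h n x hx))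
  obtain ⟨Q, hQ⟩ := exists_clusterPt_of_compactSpace (map P atTop)
  exact ⟨Q, hcluster Q hQ, le_nhds_of_unique_clusterPt fun R hR =>
    (hcluster Q hQ).unique (hcluster R hR)⟩

theorem correlation_shiftProcess (P : ProbabilityMeasure (Conf ℤ)) (k : ℤ) {n : ℕ}
    (x : Fin n → ℤ) :
    correlation (shiftProcess k P) x = correlation P (fun i => x i + k) := by
  rw [correlation, shiftProcess, ProbabilityMeasure.toMeasure_map, measureReal_def,
    Measure.map_apply (measurable_shiftLeft k) (measurableSet_forall_eq_true x)]
  rfl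

theorem IsDeterminantal.isTranslationInvariant {P : ProbabilityMeasure (Conf ℤ)}
    {K : ℤ → ℤ → ℝ} (hP : IsDeterminantal P K) (hK : ∀ k x y, K (x + k) (y + k) = K x y) :
    IsTranslationInvariant P := fun k => hP.unique fun n x hx => by
  rw [correlation_shiftProcess, hP n (fun i => x i + k) ((add_left_injective k).comp hx)]
  simp only [hK]

theorem discreteSineKernel_add_right (φ : ℝ) (k x y : ℤ) :
    discreteSineKernel φ (x + k) (y + k) = discreteSineKernel φ x y := by
  simp [discreteSineKernel]

/-! ### Determinantal ensembles from Slater determinants -/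

/-- **Andréief's identity**, the summed form of the Cauchy–Binet formula. -/
theorem sum_det_mul_det {R ι : Type*} [CommRing R] (A : Finset ι) {N : ℕ}
    (a b : Fin N → ι → R) :
    ∑ f ∈ Fintype.piFinset fun _ : Fin N => A,
      (Matrix.of fun i j => a i (f j)).det * (Matrix.of fun i j => b i (f j)).det =
    (N.factorial : R) * (Matrix.of fun i j => ∑ x ∈ A, a i x * b j x).det := by
  have h1 : ∀ σ τ : Equiv.Perm (Fin N),
      ∑ f ∈ Fintype.piFinset fun _ : Fin N => A, ∏ j, a (σ j) (f j) * b (τ j) (f j) =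
        ∏ j, ∑ x ∈ A, a (σ j) x * b (τ j) x := fun σ τ =>
    (Finset.prod_univ_sum (fun _ => A) fun j x => a (σ j) x * b (τ j) x).symm
  -- for fixed `σ` the sum over `τ` is the Gram determinant with rows permuted by `σ`
  have h2 : ∀ σ : Equiv.Perm (Fin N),
      ∑ τ : Equiv.Perm (Fin N), ((τ.sign : ℤ) : R) * ∏ j, ∑ x ∈ A, a (σ j) x * b (τ j) x =
        ((σ.sign : ℤ) : R) * (Matrix.of fun i j => ∑ x ∈ A, a i x * b j x).det := fun σ => by
    rw [← Matrix.det_permute, ← Matrix.det_transpose, Matrix.det_apply']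
    rfl
  calc _ = ∑ f ∈ Fintype.piFinset fun _ : Fin N => A, ∑ σ : Equiv.Perm (Fin N),
        ∑ τ : Equiv.Perm (Fin N), ((σ.sign : ℤ) : R) *
          (((τ.sign : ℤ) : R) * ∏ j, a (σ j) (f j) * b (τ j) (f j)) := by
        refine Finset.sum_congr rfl fun f _ => ?_
        rw [Matrix.det_apply', Matrix.det_apply', Finset.sum_mul_sum]
        refine Finset.sum_congr rfl fun σ _ => Finset.sum_congr rfl fun τ _ => ?_
        simp only [Matrix.of_apply, Finset.prod_mul_distrib]
        ring
    _ = ∑ σ : Equiv.Perm (Fin N), ((σ.sign : ℤ) : R) * ∑ τ : Equiv.Perm (Fin N),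
          ((τ.sign : ℤ) : R) * ∏ j, ∑ x ∈ A, a (σ j) x * b (τ j) x := by
        rw [Finset.sum_comm]
        refine Finset.sum_congr rfl fun σ _ => ?_
        rw [Finset.sum_comm, Finset.mul_sum]
        refine Finset.sum_congr rfl fun τ _ => ?_
        rw [← h1, Finset.mul_sum, Finset.mul_sum]
    _ = ∑ σ : Equiv.Perm (Fin N), (Matrix.of fun i j => ∑ x ∈ A, a i x * b j x).det := by
        refine Finset.sum_congr rfl fun σ _ => ?_
        rw [h2, ← mul_assoc, ← Int.cast_mul]
        simp
    _ = _ := by simp [Fintype.card_perm]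

/-- Correlations of the ensemble with ordered weight `det (u i (f j)) ^ 2`. Each point of `range y`
in the configuration is marked by a variable `X`; the Andréief identity and `det (1 + A * B) =
det (1 + B * A)` turn the generating function into `det (X • K + (1 - K))`, whose top coefficient
is `det K`, while on the other side it counts the configurations containing `range y`. -/
theorem sum_det_sq_of_range_subset {ι : Type*} [DecidableEq ι] (A : Finset ι) {N n : ℕ}
    (u : Fin N → ι → ℝ)
    (hu : ∀ i j, ∑ x ∈ A, u i x * u j x = if i = j then 1 else 0)
    (y : Fin n → ι) (hy : Function.Injective y) (hyA : ∀ k, y k ∈ A) :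
    ∑ f ∈ Fintype.piFinset (fun _ : Fin N => A) with ∀ k, ∃ i, f i = y k,
      (Matrix.of fun i j => u i (f j)).det ^ 2 =
    (N.factorial : ℝ) * (Matrix.of fun k l => ∑ i, u i (y k) * u i (y l)).det := by
  classical
  let Y : Finset ι := Finset.univ.image y
  have hY : Y ⊆ A := fun x hx => by
    obtain ⟨k, -, rfl⟩ := Finset.mem_image.1 hx
    exact hyA k
  have hYcard : Y.card = n := by
    simp [Y, Finset.card_image_of_injective _ hy]
  let t : ι → ℝ[X] := fun x => if x ∈ Y then X else 1
  let K : Matrix (Fin n) (Fin n) ℝ := Matrix.of fun k l => ∑ i, u i (y k) * u i (y l)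
  -- the left side of the Andréief identity
  have hleft : ∀ f : Fin N → ι,
      (Matrix.of fun i j => t (f j) * C (u i (f j))).det *
        (Matrix.of fun i j => C (u i (f j))).det =
      X ^ (Finset.univ.filter fun j => f j ∈ Y).card *
        C ((Matrix.of fun i j => u i (f j)).det ^ 2) := fun f => by
    have h0 : (Matrix.of fun i j => (C (u i (f j)) : ℝ[X])).det =
        C (Matrix.of fun i j => u i (f j)).det := by
      rw [RingHom.map_det]; rfl
    rw [show (Matrix.of fun i j => t (f j) * C (u i (f j))) =
        Matrix.of fun i j => t (f j) * (Matrix.of fun i j => (C (u i (f j)) : ℝ[X])) i j from rfl,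
      Matrix.det_mul_row, h0]
    have ht : ∏ j, t (f j) = X ^ (Finset.univ.filter fun j => f j ∈ Y).card := by
      simp only [t, Finset.prod_ite, Finset.prod_const_one, mul_one, Finset.prod_const]
    rw [ht, pow_two, C_mul]
    ring
  -- the right side of the Andréief identity
  have hright : (Matrix.of fun i j => ∑ x ∈ A, (t x * C (u i x)) * C (u j x)).det =
      ((X : ℝ[X]) • K.map C + (1 - K).map C).det := by
    let U : Matrix (Fin N) (Fin n) ℝ[X] := Matrix.of fun i k => C (u i (y k))
    have hG : (Matrix.of fun i j => ∑ x ∈ A, (t x * C (u i x)) * C (u j x)) =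
        1 + U * ((X - 1 : ℝ[X]) • U.transpose) := by
      ext1 i j
      have e1 : ∀ x, (t x * C (u i x)) * C (u j x) = C (u i x * u j x) +
          if x ∈ Y then (X - 1) * C (u i x * u j x) else 0 := fun x => by
        by_cases hx : x ∈ Y <;> simp only [t, hx, if_true, if_false, C_mul] <;> ring
      have e2 : A.filter (· ∈ Y) = Y := by
        ext x; simpa using fun h => hY h
      simp only [Matrix.of_apply, e1, Finset.sum_add_distrib, ← map_sum, hu, Matrix.add_apply,
        ← Finset.sum_filter, e2]
      congr 1
      · by_cases hij : i = j <;> simp [hij, Matrix.one_apply]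
      · rw [Finset.sum_image fun _ _ _ _ h => hy h]
        simp only [Matrix.mul_apply, Matrix.smul_apply, Matrix.transpose_apply, U, Matrix.of_apply,
          smul_eq_mul, C_mul]
        exact Finset.sum_congr rfl fun k _ => by ring
    rw [hG, Matrix.det_one_add_mul_comm]
    congr 1
    ext1 k l
    have e3 : (U.transpose * U) k l = C (K k l) := by
      simp [U, K, Matrix.mul_apply]
    rw [Matrix.smul_mul]
    simp only [Matrix.add_apply, Matrix.smul_apply, e3, Matrix.map_apply, Matrix.sub_apply,
      smul_eq_mul, C_sub]
    have e4 : C ((1 : Matrix (Fin n) (Fin n) ℝ) k l) = (1 : Matrix (Fin n) (Fin n) ℝ[X]) k l := by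
      by_cases hkl : k = l <;> simp [hkl, Matrix.one_apply]
    rw [e4]
    ring
  have key := sum_det_mul_det A (fun i x => t x * C (u i x)) fun i x => C (u i x)
  simp only [hleft] at key
  rw [hright] at key
  have key' := congrArg (fun P : ℝ[X] => P.coeff n) key
  have e4 : ((X : ℝ[X]) • K.map C + (1 - K).map C).det.coeff n = K.det := by
    simpa using Polynomial.coeff_det_X_add_C_card K (1 - K)
  simp only [finsetSum_coeff, ← Polynomial.C_eq_natCast, coeff_C_mul, coeff_mul_C, e4] at key'
  rw [← key', Finset.sum_filter]
  refine Finset.sum_congr rfl fun f _ => ?_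
  rw [coeff_X_pow]
  by_cases hf : Function.Injective f
  · have e5 : (Finset.univ.filter fun j => f j ∈ Y).card = (Y ∩ Finset.univ.image f).card := by
      rw [← Finset.card_image_of_injective _ hf]
      congr 1
      ext x
      simp only [Finset.mem_image, Finset.mem_filter, Finset.mem_inter, Finset.mem_univ, true_and]
      constructor
      · rintro ⟨j, h, rfl⟩; exact ⟨h, j, rfl⟩
      · rintro ⟨h, j, rfl⟩; exact ⟨j, h, rfl⟩
    have e6 : (n = (Finset.univ.filter fun j => f j ∈ Y).card) ↔ ∀ k, ∃ i, f i = y k := by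
      rw [e5]
      constructor
      · intro h k
        rw [← hYcard] at h
        have h1 := Finset.eq_of_subset_of_card_le Finset.inter_subset_left h.le
        have h2 : y k ∈ Y ∩ Finset.univ.image f := by
          rw [h1]; exact Finset.mem_image_of_mem _ (Finset.mem_univ k)
        simpa using (Finset.mem_inter.1 h2).2
      · intro h
        rw [Finset.inter_eq_left.2, hYcard]
        intro x hx
        obtain ⟨k, -, rfl⟩ := Finset.mem_image.1 hx
        simpa using h k
    by_cases h : ∀ k, ∃ i, f i = y k
    · rw [if_pos h, if_pos (e6.2 h), one_mul]
    · rw [if_neg h, if_neg fun h' => h (e6.1 h'), zero_mul]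
  · have e7 : (Matrix.of fun i j => u i (f j)).det = 0 := by
      simp only [Function.Injective, not_forall] at hf
      obtain ⟨i, j, hij, hne⟩ := hf
      exact Matrix.det_zero_of_column_eq hne fun k => by simp [hij]
    simp [e7]

/-- A configuration of `N` points has `N!` orderings. -/
theorem card_injective_image_eq {ι : Type*} [DecidableEq ι] {N : ℕ} {A S : Finset ι}
    (hS : S ∈ A.powersetCard N) :
    ((Fintype.piFinset fun _ : Fin N => A).filter
      fun f => Function.Injective f ∧ Finset.univ.image f = S).card = N.factorial := by
  classical
  obtain ⟨hSA, hcard⟩ := Finset.mem_powersetCard.1 hS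
  have hcard' : Fintype.card (Fin N) = Fintype.card S := by simp [hcard]
  have hequiv : Fintype.card (Fin N ≃ S) = N.factorial := by
    rw [Fintype.card_equiv (Fintype.equivOfCardEq hcard'), Fintype.card_fin]
  rw [← hequiv, ← Finset.card_univ]
  symm
  refine Finset.card_bij (fun e _ => fun i => (e i : ι)) ?_ ?_ ?_
  · intro e _
    simp only [Finset.mem_filter, Fintype.mem_piFinset]
    refine ⟨fun i => hSA (e i).2, Subtype.val_injective.comp e.injective, ?_⟩
    ext x
    simp only [Finset.mem_image, Finset.mem_univ, true_and]
    exact ⟨fun ⟨i, hi⟩ => hi ▸ (e i).2, fun hx => ⟨e.symm ⟨x, hx⟩, by simp⟩⟩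
  · intro e _ e' _ h
    ext i
    exact congrFun h i
  · intro f hf
    obtain ⟨-, hinj, him⟩ := Finset.mem_filter.1 hf
    have hmem : ∀ i, f i ∈ S := fun i => him ▸ Finset.mem_image_of_mem f (Finset.mem_univ i)
    refine ⟨Equiv.ofBijective (fun i => ⟨f i, hmem i⟩)
      ((Fintype.bijective_iff_injective_and_card _).2 ⟨fun i j h => hinj ?_, hcard'⟩),
      Finset.mem_univ _, rfl⟩
    simpa using h

theorem sum_injective_eq_factorial_mul_sum {ι : Type*} [DecidableEq ι] (A : Finset ι) (N : ℕ)
    (F : Finset ι → ℝ) :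
    ∑ f ∈ Fintype.piFinset (fun _ : Fin N => A) with Function.Injective f,
      F (Finset.univ.image f) = N.factorial * ∑ S ∈ A.powersetCard N, F S := by
  have hmaps : ∀ f ∈ (Fintype.piFinset fun _ : Fin N => A).filter fun f => Function.Injective f,
      Finset.univ.image f ∈ A.powersetCard N := fun f hf => by
    obtain ⟨h1, h2⟩ := Finset.mem_filter.1 hf
    rw [Fintype.mem_piFinset] at h1
    refine Finset.mem_powersetCard.2 ⟨fun x hx => ?_, ?_⟩
    · obtain ⟨i, -, rfl⟩ := Finset.mem_image.1 hx
      exact h1 i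
    · simp [Finset.card_image_of_injective _ h2]
  rw [← Finset.sum_fiberwise_of_maps_to hmaps, Finset.mul_sum]
  refine Finset.sum_congr rfl fun S hS => ?_
  rw [Finset.sum_congr rfl fun f hf => by rw [(Finset.mem_filter.1 hf).2], Finset.sum_const,
    Finset.filter_filter, card_injective_image_eq hS, nsmul_eq_mul]

/-- If the weight of a configuration is
proportional to the squared Slater determinant of an orthonormal system `u`, then the
probability of containing `range y` is the minor of the projection kernel `∑ i, u i x * u i y`. -/
theorem sum_weight_div_sum_weight {ι : Type*} [DecidableEq ι] (A : Finset ι) {N n : ℕ}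
    (u : Fin N → ι → ℝ)
    (hu : ∀ i j, ∑ x ∈ A, u i x * u j x = if i = j then 1 else 0)
    (w : Finset ι → ℝ) {κ : ℝ} (hκ : κ ≠ 0)
    (hw : ∀ f : Fin N → ι, (∀ i, f i ∈ A) → Function.Injective f →
      w (Finset.univ.image f) = κ * (Matrix.of fun i j => u i (f j)).det ^ 2)
    (y : Fin n → ι) (hy : Function.Injective y) (hyA : ∀ k, y k ∈ A) :
    (∑ S ∈ A.powersetCard N with ∀ k, y k ∈ S, w S) / ∑ S ∈ A.powersetCard N, w S =
      (Matrix.of fun k l => ∑ i, u i (y k) * u i (y l)).det := by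
  have main : ∀ {m : ℕ} (z : Fin m → ι), Function.Injective z → (∀ k, z k ∈ A) →
      ∑ S ∈ A.powersetCard N with ∀ k, z k ∈ S, w S =
        κ * (Matrix.of fun k l => ∑ i, u i (z k) * u i (z l)).det := fun {m} z hz hzA => by
    have hfac : (N.factorial : ℝ) ≠ 0 := by positivity
    refine mul_left_cancel₀ hfac ?_
    rw [mul_left_comm, ← sum_det_sq_of_range_subset A u hu z hz hzA, Finset.sum_filter,
      ← sum_injective_eq_factorial_mul_sum A N fun S => if ∀ k, z k ∈ S then w S else 0,
      Finset.mul_sum, Finset.sum_filter, Finset.sum_filter]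
    refine Finset.sum_congr rfl fun f hf => ?_
    rw [Fintype.mem_piFinset] at hf
    simp only [Finset.mem_image, Finset.mem_univ, true_and]
    by_cases hinj : Function.Injective f
    · rw [if_pos hinj, hw f hf hinj]
    · rw [if_neg hinj]
      simp only [Function.Injective, not_forall] at hinj
      obtain ⟨i, j, hij, hne⟩ := hinj
      rw [Matrix.det_zero_of_column_eq hne fun k => by simp [hij]]
      simp
  -- the normalization is the case of no marked point
  have h0 := main (Fin.elim0 : Fin 0 → ι) (fun i => i.elim0) fun i => i.elim0
  simp only [IsEmpty.forall_iff, Finset.filter_true, Matrix.det_isEmpty, mul_one] at h0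
  rw [main y hy hyA, h0, mul_div_cancel_left₀ _ hκ]

/-! ### Krawtchouk polynomials -/

/-- The coefficient of the falling factorial `x (x - 1) ⋯ (x - k + m + 1)` in the monic Krawtchouk
polynomial of degree `k`. -/
def krawtchoukCoeff (p : ℝ) (L k m : ℕ) : ℝ :=
  ∏ i ∈ Finset.range m, -(p * ((k : ℝ) - i) * ((L : ℝ) - k + i + 1) / ((i : ℝ) + 1))

/-- The monic Krawtchouk polynomial of degree `k`, expanded in falling factorials. -/
def krawtchoukPoly (p : ℝ) (L k : ℕ) : ℝ[X] :=
  ∑ m ∈ Finset.range (k + 1), C (krawtchoukCoeff p L k m) * descPochhammer ℝ (k - m)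

theorem krawtchoukCoeff_succ_mul (p : ℝ) (L k m : ℕ) :
    ((m : ℝ) + 1) * krawtchoukCoeff p L k (m + 1) =
      -(krawtchoukCoeff p L k m * (p * ((k : ℝ) - m) * ((L : ℝ) - k + m + 1))) := by
  have h : (m : ℝ) + 1 ≠ 0 := by positivity
  rw [krawtchoukCoeff, Finset.prod_range_succ, ← krawtchoukCoeff]
  field_simp

theorem krawtchoukCoeff_self_succ (p : ℝ) (L k : ℕ) : krawtchoukCoeff p L k (k + 1) = 0 :=
  Finset.prod_eq_zero (Finset.self_mem_range_succ k) (by simp)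

theorem krawtchoukPoly_eq (p : ℝ) (L k : ℕ) :
    krawtchoukPoly p L k = descPochhammer ℝ k +
      ∑ m ∈ Finset.range k,
        C (krawtchoukCoeff p L k (m + 1)) * descPochhammer ℝ (k - (m + 1)) := by
  rw [krawtchoukPoly, Finset.sum_range_succ', add_comm]
  simp [krawtchoukCoeff]

theorem degree_krawtchoukPoly_sub_lt (p : ℝ) (L k : ℕ) :
    (∑ m ∈ Finset.range k,
      C (krawtchoukCoeff p L k (m + 1)) * descPochhammer ℝ (k - (m + 1))).degree < k := by
  rw [← mem_degreeLT]
  refine Submodule.sum_mem _ fun m hm => ?_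
  rw [C_mul']
  refine Submodule.smul_mem _ _ (mem_degreeLT.2 ?_)
  rw [degree_eq_natDegree (monic_descPochhammer ℝ _).ne_zero, descPochhammer_natDegree]
  have := Finset.mem_range.1 hm
  exact_mod_cast (by omega : k - (m + 1) < k)

theorem degree_descPochhammer (k : ℕ) : (descPochhammer ℝ k).degree = k := by
  rw [degree_eq_natDegree (monic_descPochhammer ℝ _).ne_zero, descPochhammer_natDegree]

theorem krawtchoukPoly_monic (p : ℝ) (L k : ℕ) : (krawtchoukPoly p L k).Monic := by
  rw [krawtchoukPoly_eq]
  exact (monic_descPochhammer ℝ k).add_of_left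
    (by rw [degree_descPochhammer]; exact degree_krawtchoukPoly_sub_lt p L k)

theorem natDegree_krawtchoukPoly (p : ℝ) (L k : ℕ) : (krawtchoukPoly p L k).natDegree = k := by
  refine natDegree_eq_of_degree_eq_some ?_
  rw [krawtchoukPoly_eq, degree_add_eq_left_of_degree_lt, degree_descPochhammer]
  rw [degree_descPochhammer]
  exact degree_krawtchoukPoly_sub_lt p L k

theorem descPochhammer_eval_add_one (j : ℕ) (x : ℝ) :
    (descPochhammer ℝ (j + 1)).eval (x + 1) = (x + 1) * (descPochhammer ℝ j).eval x := by
  rw [descPochhammer_succ_left]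
  simp

theorem mul_descPochhammer_eval_sub_one (j : ℕ) (x : ℝ) :
    x * (descPochhammer ℝ j).eval (x - 1) = (descPochhammer ℝ (j + 1)).eval x := by
  rw [descPochhammer_succ_left]
  simp

/-- The Krawtchouk difference operator is bidiagonal in the basis of falling factorials. -/
theorem krawtchouk_difference_descPochhammer (p : ℝ) (L j : ℕ) (x : ℝ) :
    p * (L - x) * ((descPochhammer ℝ j).eval (x + 1) - (descPochhammer ℝ j).eval x) +
      (1 - p) * x * ((descPochhammer ℝ j).eval (x - 1) - (descPochhammer ℝ j).eval x) =
    -(j * (descPochhammer ℝ j).eval x) +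
      p * j * (L - j + 1) * (descPochhammer ℝ (j - 1)).eval x := by
  cases j with
  | zero => simp
  | succ j =>
    have h1 := descPochhammer_eval_add_one j x
    have h2 := mul_descPochhammer_eval_sub_one (j + 1) x
    have h3 := descPochhammer_succ_eval j x
    have h4 := descPochhammer_succ_eval (j + 1) x
    rw [mul_sub ((1 - p) * x), mul_assoc (1 - p), h2, h4, h1, h3]
    rw [Nat.add_sub_cancel]
    push_cast
    ring

/-- The difference equation of the Krawtchouk polynomials. -/
theorem krawtchoukPoly_difference (p : ℝ) (L k : ℕ) (x : ℝ) :
    p * (L - x) * ((krawtchoukPoly p L k).eval (x + 1) - (krawtchoukPoly p L k).eval x) +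
      (1 - p) * x * ((krawtchoukPoly p L k).eval (x - 1) - (krawtchoukPoly p L k).eval x) =
    -(k * (krawtchoukPoly p L k).eval x) := by
  set d := krawtchoukCoeff p L k with hd
  let e : ℕ → ℝ → ℝ := fun m z => (descPochhammer ℝ (k - m)).eval z
  have heval : ∀ z, (krawtchoukPoly p L k).eval z = ∑ m ∈ Finset.range (k + 1), d m * e m z :=
    fun z => by simp [krawtchoukPoly, eval_finsetSum, e, hd]
  have hterm : ∀ m ∈ Finset.range (k + 1),
      p * (L - x) * (d m * e m (x + 1) - d m * e m x) +
        (1 - p) * x * (d m * e m (x - 1) - d m * e m x) =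
      -(k * (d m * e m x)) + (m * (d m * e m x) -
        ((m + 1 : ℕ) : ℝ) * (d (m + 1) * e (m + 1) x)) := fun m hm => by
    have hmk : m ≤ k := Nat.lt_succ_iff.1 (Finset.mem_range.1 hm)
    have h1 := krawtchouk_difference_descPochhammer p L (k - m) x
    have h2 := krawtchoukCoeff_succ_mul p L k m
    rw [Nat.sub_sub, Nat.cast_sub hmk] at h1
    change p * (L - x) * (e m (x + 1) - e m x) + (1 - p) * x * (e m (x - 1) - e m x) =
      -((k - m) * e m x) + p * (k - m) * (L - (k - m) + 1) * e (m + 1) x at h1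
    rw [← hd] at h2
    push_cast
    linear_combination d m * h1 + e (m + 1) x * h2
  simp only [heval]
  rw [← Finset.sum_sub_distrib, ← Finset.sum_sub_distrib, Finset.mul_sum, Finset.mul_sum,
    ← Finset.sum_add_distrib, Finset.sum_congr rfl hterm, Finset.sum_add_distrib,
    Finset.sum_range_sub' fun m : ℕ => (m : ℝ) * (d m * e m x), Finset.sum_neg_distrib,
    ← Finset.mul_sum, hd, krawtchoukCoeff_self_succ]
  simp

/-! ### The symmetrized Krawtchouk operator and its eigenfunctions -/

/-- The Jacobi (tridiagonal symmetric) operator on functions on `ℤ` with the entry `α x` between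
`x` and `x + 1` and the diagonal entry `β x`. -/
def jacobi (α β f : ℤ → ℝ) (x : ℤ) : ℝ :=
  α x * f (x + 1) + β x * f x + α (x - 1) * f (x - 1)

/-- Off-diagonal entries of the symmetrized Krawtchouk difference operator. The square root of a
negative number being `0`, they vanish outside `0 ≤ x < L`. -/
def krawtchoukOffDiag (p : ℝ) (L : ℕ) (x : ℤ) : ℝ :=
  √(p * (1 - p) * ((L - x) * (x + 1)))

/-- Diagonal entries of the symmetrized Krawtchouk difference operator, which is shifted by `L / 2`
to make its spectrum symmetric. -/
def krawtchoukDiag (p : ℝ) (L : ℕ) (x : ℤ) : ℝ := (1 - 2 * p) * ((L : ℝ) / 2 - x)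

/-- The square root of the Krawtchouk weight, extended by zero to `ℤ`. -/
def sqrtWeight (p : ℝ) (L : ℕ) (x : ℤ) : ℝ :=
  if 0 ≤ x then √(krawtchoukWeight p L x.toNat) else 0

theorem sqrtWeight_natCast (p : ℝ) (L x : ℕ) :
    sqrtWeight p L x = √(krawtchoukWeight p L x) := by
  simp [sqrtWeight]

theorem sqrtWeight_of_neg (p : ℝ) (L : ℕ) {x : ℤ} (hx : x < 0) : sqrtWeight p L x = 0 :=
  if_neg hx.not_ge

theorem sqrtWeight_of_gt (p : ℝ) {L : ℕ} {x : ℤ} (hx : L < x) : sqrtWeight p L x = 0 := by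
  obtain ⟨n, rfl⟩ := Int.eq_ofNat_of_zero_le (by omega : 0 ≤ x)
  rw [sqrtWeight_natCast, krawtchoukWeight, Nat.choose_eq_zero_of_lt (by omega)]
  simp

theorem krawtchoukWeight_pos {p : ℝ} (hp : p ∈ Set.Ioo (0 : ℝ) 1) {L x : ℕ} (hx : x ≤ L) :
    0 < krawtchoukWeight p L x := by
  have h1 : (0 : ℝ) < L.choose x := by exact_mod_cast Nat.choose_pos hx
  have h2 : 0 < 1 - p := by linarith [hp.2]
  have := hp.1
  unfold krawtchoukWeight
  positivity

theorem krawtchoukWeight_succ (p : ℝ) {L x : ℕ} (hx : x < L) :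
    krawtchoukWeight p L (x + 1) * ((1 - p) * (x + 1)) =
      krawtchoukWeight p L x * (p * (L - x)) := by
  have h1 : (L.choose (x + 1) : ℝ) * (x + 1) = L.choose x * (L - x) := by
    rw [← Nat.cast_sub hx.le]
    exact_mod_cast Nat.choose_succ_right_eq L x
  obtain ⟨r, rfl⟩ : ∃ r, L = x + 1 + r := ⟨L - (x + 1), by omega⟩
  rw [krawtchoukWeight, krawtchoukWeight, show x + 1 + r - (x + 1) = r by omega,
    show x + 1 + r - x = r + 1 by omega, pow_succ, pow_succ]
  linear_combination p ^ x * p * (1 - p) ^ r * (1 - p) * h1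

/-- The square root of the weight conjugates the symmetric off-diagonal entries into the
coefficients of the Krawtchouk difference equation. -/
theorem krawtchoukOffDiag_mul_sqrtWeight_succ {p : ℝ} (hp : p ∈ Set.Ioo (0 : ℝ) 1) (L : ℕ)
    (x : ℤ) :
    krawtchoukOffDiag p L x * sqrtWeight p L (x + 1) = p * (L - x) * sqrtWeight p L x ∧
      krawtchoukOffDiag p L x * sqrtWeight p L x =
        (1 - p) * (x + 1) * sqrtWeight p L (x + 1) := by
  obtain ⟨hp0, hp1⟩ := hp
  have hq : 0 < 1 - p := by linarith
  rcases lt_or_ge x 0 with hx | hx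
  · rw [sqrtWeight_of_neg p L hx]
    rcases (by omega : x = -1 ∨ x + 1 < 0) with rfl | hx'
    · simp [krawtchoukOffDiag]
    · simp [sqrtWeight_of_neg p L hx']
  rcases lt_or_ge x L with hxL | hxL
  · obtain ⟨n, rfl⟩ := Int.eq_ofNat_of_zero_le hx
    have hn : n < L := by exact_mod_cast hxL
    have hL : (0 : ℝ) < (L : ℝ) - n := sub_pos.2 (by exact_mod_cast hn)
    have hW := krawtchoukWeight_succ p hn
    have hc : ((n : ℤ) : ℝ) = n := by simp
    have hn1 : ((n : ℤ) + 1) = ((n + 1 : ℕ) : ℤ) := by simp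
    rw [hn1, sqrtWeight_natCast, sqrtWeight_natCast, krawtchoukOffDiag, hc]
    have hw0 := krawtchoukWeight_pos ⟨hp0, hp1⟩ hn.le
    have hw1 := krawtchoukWeight_pos ⟨hp0, hp1⟩ (show n + 1 ≤ L from hn)
    set w0 := krawtchoukWeight p L n
    set w1 := krawtchoukWeight p L (n + 1)
    constructor
    · rw [← Real.sqrt_mul (by positivity), ← Real.sqrt_sq (show 0 ≤ p * ((L : ℝ) - n) by positivity),
        ← Real.sqrt_mul (by positivity)]
      congr 1
      linear_combination p * ((L : ℝ) - n) * hW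
    · rw [← Real.sqrt_mul (by positivity),
        ← Real.sqrt_sq (show 0 ≤ (1 - p) * ((n : ℝ) + 1) by positivity),
        ← Real.sqrt_mul (by positivity)]
      congr 1
      linear_combination -((1 - p) * ((n : ℝ) + 1)) * hW
  · rw [sqrtWeight_of_gt p (show (L : ℤ) < x + 1 by omega)]
    rcases hxL.eq_or_lt with h | h
    · subst h; simp [krawtchoukOffDiag]
    · simp [sqrtWeight_of_gt p h]

/-- The Krawtchouk function of index `n`: the polynomial times the square root of the weight. -/
def krawtchoukFun (p : ℝ) (L n : ℕ) (x : ℤ) : ℝ :=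
  sqrtWeight p L x * (krawtchoukPoly p L n).eval (x : ℝ)

theorem jacobi_krawtchoukFun {p : ℝ} (hp : p ∈ Set.Ioo (0 : ℝ) 1) (L n : ℕ) (x : ℤ) :
    jacobi (krawtchoukOffDiag p L) (krawtchoukDiag p L) (krawtchoukFun p L n) x =
      ((L : ℝ) / 2 - n) * krawtchoukFun p L n x := by
  have h1 := (krawtchoukOffDiag_mul_sqrtWeight_succ hp L x).1
  have h2 := (krawtchoukOffDiag_mul_sqrtWeight_succ hp L (x - 1)).2
  have h3 := krawtchoukPoly_difference p L n x
  simp only [jacobi, krawtchoukFun, krawtchoukDiag]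
  rw [sub_add_cancel] at h2
  push_cast at h2 ⊢
  linear_combination (krawtchoukPoly p L n).eval ((x : ℝ) + 1) * h1 +
    (krawtchoukPoly p L n).eval ((x : ℝ) - 1) * h2 + sqrtWeight p L x * h3

/-- `jacobi` is symmetric on `{0, …, L}` as soon as the two entries leaving the interval vanish:
`(J f) g - f (J g)` is the difference of consecutive discrete Wronskians. -/
theorem sum_jacobi_mul_sub (α β f g : ℤ → ℝ) (L : ℕ) (h0 : α (-1) = 0) (hL : α L = 0) :
    ∑ i ∈ Finset.range (L + 1), jacobi α β f i * g i =
      ∑ i ∈ Finset.range (L + 1), f i * jacobi α β g i := by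
  -- the discrete Wronskian at `i - 1`
  let w : ℕ → ℝ := fun i => α ((i : ℤ) - 1) *
    (f i * g ((i : ℤ) - 1) - f ((i : ℤ) - 1) * g i)
  have h : ∀ i : ℕ, jacobi α β f i * g i - f i * jacobi α β g i = w (i + 1) - w i := fun i => by
    simp only [jacobi, w]
    push_cast
    rw [add_sub_cancel_right]
    ring
  rw [← sub_eq_zero, ← Finset.sum_sub_distrib, Finset.sum_congr rfl fun i _ => h i,
    Finset.sum_range_sub]
  simp [w, h0, hL]

theorem sum_krawtchoukFun_mul_of_ne {p : ℝ} (hp : p ∈ Set.Ioo (0 : ℝ) 1) (L : ℕ) {m n : ℕ}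
    (hmn : m ≠ n) :
    ∑ i ∈ Finset.range (L + 1), krawtchoukFun p L m i * krawtchoukFun p L n i = 0 := by
  have h := sum_jacobi_mul_sub (krawtchoukOffDiag p L) (krawtchoukDiag p L)
    (krawtchoukFun p L m) (krawtchoukFun p L n) L (by simp [krawtchoukOffDiag])
    (by simp [krawtchoukOffDiag])
  simp only [jacobi_krawtchoukFun hp] at h
  rw [← sub_eq_zero, ← Finset.sum_sub_distrib] at h
  have hne : (n : ℝ) - m ≠ 0 := sub_ne_zero.2 (by exact_mod_cast hmn.symm)
  refine (mul_eq_zero.1 (?_ : ((n : ℝ) - m) * _ = 0)).resolve_left hne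
  rw [Finset.mul_sum, ← h]
  exact Finset.sum_congr rfl fun i _ => by ring

/-- The squared norm of a Krawtchouk function. -/
def krawtchoukNormSq (p : ℝ) (L n : ℕ) : ℝ :=
  ∑ i ∈ Finset.range (L + 1), krawtchoukFun p L n i * krawtchoukFun p L n i

theorem krawtchoukNormSq_pos {p : ℝ} (hp : p ∈ Set.Ioo (0 : ℝ) 1) {L n : ℕ} (hn : n ≤ L) :
    0 < krawtchoukNormSq p L n := by
  refine (Finset.sum_nonneg fun i _ => mul_self_nonneg _).lt_of_ne' fun h0 => ?_
  rw [Finset.sum_eq_zero_iff_of_nonneg fun i _ => mul_self_nonneg _] at h0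
  -- a polynomial of degree `n ≤ L` cannot vanish at `L + 1` points
  refine (krawtchoukPoly_monic p L n).ne_zero
    (eq_zero_of_natDegree_lt_card_of_eval_eq_zero' _
      ((Finset.range (L + 1)).map Nat.castEmbedding) (fun x hx => ?_) ?_)
  · obtain ⟨i, hi, rfl⟩ := Finset.mem_map.1 hx
    have h1 := mul_self_eq_zero.1 (h0 i hi)
    rw [krawtchoukFun, sqrtWeight_natCast] at h1
    have h2 := (Real.sqrt_pos.2
      (krawtchoukWeight_pos hp (Nat.lt_succ_iff.1 (Finset.mem_range.1 hi)))).ne'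
    simpa using (mul_eq_zero.1 h1).resolve_left h2
  · rw [natDegree_krawtchoukPoly, Finset.card_map, Finset.card_range]
    omega

/-- The orthonormal Krawtchouk functions. -/
def krawtchoukONB (p : ℝ) (L n : ℕ) (x : ℤ) : ℝ :=
  krawtchoukFun p L n x / √(krawtchoukNormSq p L n)

theorem sum_krawtchoukONB_mul {p : ℝ} (hp : p ∈ Set.Ioo (0 : ℝ) 1) {L m n : ℕ} (hm : m ≤ L) :
    ∑ i ∈ Finset.range (L + 1), krawtchoukONB p L m i * krawtchoukONB p L n i =
      if m = n then 1 else 0 := by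
  simp only [krawtchoukONB, div_mul_div_comm, ← Finset.sum_div]
  split_ifs with h
  · subst h
    have hpos := krawtchoukNormSq_pos hp hm
    rw [Real.mul_self_sqrt hpos.le]
    exact div_self hpos.ne'
  · rw [sum_krawtchoukFun_mul_of_ne hp L h, zero_div]

theorem jacobi_krawtchoukONB {p : ℝ} (hp : p ∈ Set.Ioo (0 : ℝ) 1) (L n : ℕ) (x : ℤ) :
    jacobi (krawtchoukOffDiag p L) (krawtchoukDiag p L) (krawtchoukONB p L n) x =
      ((L : ℝ) / 2 - n) * krawtchoukONB p L n x := by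
  have h := jacobi_krawtchoukFun hp L n x
  simp only [jacobi, krawtchoukONB] at h ⊢
  rw [← mul_div_assoc (((L : ℝ) / 2 - n)), ← h]
  ring

theorem krawtchoukONB_eq_zero (p : ℝ) (L n : ℕ) {x : ℤ} (hx : ¬(0 ≤ x ∧ x ≤ L)) :
    krawtchoukONB p L n x = 0 := by
  rcases (by omega : x < 0 ∨ (L : ℤ) < x) with h | h
  · simp [krawtchoukONB, krawtchoukFun, sqrtWeight_of_neg p L h]
  · simp [krawtchoukONB, krawtchoukFun, sqrtWeight_of_gt p h]

/-- Completeness: a square matrix with orthonormal rows has orthonormal columns. -/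
theorem sum_krawtchoukONB_mul_eq {p : ℝ} (hp : p ∈ Set.Ioo (0 : ℝ) 1) {L : ℕ} {y : ℤ}
    (hy : 0 ≤ y ∧ y ≤ L) (x : ℤ) :
    ∑ n ∈ Finset.range (L + 1), krawtchoukONB p L n x * krawtchoukONB p L n y =
      if x = y then 1 else 0 := by
  by_cases hx : 0 ≤ x ∧ x ≤ L
  · let U : Matrix (Fin (L + 1)) (Fin (L + 1)) ℝ :=
      Matrix.of fun n i => krawtchoukONB p L n ((i : ℕ) : ℤ)
    have hU : U * U.transpose = 1 := by
      ext m n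
      rw [Matrix.mul_apply, Matrix.one_apply]
      have h := sum_krawtchoukONB_mul hp (n := n) (Nat.lt_succ_iff.1 m.2)
      rw [← Fin.sum_univ_eq_sum_range
        fun i => krawtchoukONB p L m (i : ℤ) * krawtchoukONB p L n (i : ℤ)] at h
      simpa [U, Fin.ext_iff] using h
    have hU' := mul_eq_one_comm.1 hU
    have h := congrFun (congrFun hU' ⟨x.toNat, by omega⟩) ⟨y.toNat, by omega⟩
    rw [Matrix.mul_apply, Matrix.one_apply] at h
    simp only [Matrix.transpose_apply, U, Matrix.of_apply, Fin.mk.injEq, Int.toNat_of_nonneg hx.1,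
      Int.toNat_of_nonneg hy.1] at h
    rw [← Fin.sum_univ_eq_sum_range
      fun n => krawtchoukONB p L n x * krawtchoukONB p L n y, h]
    exact if_congr (by omega) rfl rfl
  · rw [if_neg (by rintro rfl; exact hx hy)]
    exact Finset.sum_eq_zero fun n _ => by rw [krawtchoukONB_eq_zero p L n hx, zero_mul]

/-! ### The Krawtchouk ensemble as a determinantal process -/

theorem prod_prod_lt_sq_eq {ι : Type*} [LinearOrder ι] (S : Finset ι) (g : ι → ι → ℝ)
    (hg : ∀ x y, g x y = g y x) :
    ∏ x ∈ S, ∏ y ∈ S with x < y, g x y ^ 2 = ∏ x ∈ S, ∏ y ∈ S with x ≠ y, g x y := by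
  have h1 : ∏ x ∈ S, ∏ y ∈ S with y < x, g x y = ∏ x ∈ S, ∏ y ∈ S with x < y, g x y := by
    simp only [Finset.prod_filter]
    rw [Finset.prod_comm]
    simp only [hg]
  have h2 : ∀ x, ∏ y ∈ S with x ≠ y, g x y =
      (∏ y ∈ S with x < y, g x y) * ∏ y ∈ S with y < x, g x y := fun x => by
    rw [← Finset.prod_union (Finset.disjoint_filter.2 fun y _ h h' => lt_asymm h h'),
      ← Finset.filter_or]
    simp only [ne_iff_lt_or_gt]
  simp only [h2, Finset.prod_mul_distrib, h1, pow_two]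

/-- The weight of the ensemble is proportional to the squared Slater determinant of the first `N`
orthonormal Krawtchouk functions, by the Vandermonde determinant of monic polynomials. -/
theorem krawtchoukEnsembleWeight_image {p : ℝ} (hp : p ∈ Set.Ioo (0 : ℝ) 1) {L N : ℕ}
    (hN : N ≤ L + 1) (f : Fin N → ℕ) (hfL : ∀ i, f i ≤ L) (hf : Function.Injective f) :
    krawtchoukEnsembleWeight p L (Finset.univ.image f) =
      (∏ i : Fin N, krawtchoukNormSq p L i) *
        (Matrix.of fun i j : Fin N => krawtchoukONB p L i (f j)).det ^ 2 := by
  let v : Fin N → ℝ := fun j => f j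
  let V : Matrix (Fin N) (Fin N) ℝ := Matrix.of fun i j => (krawtchoukPoly p L i).eval (v j)
  have hV : V.det = (Matrix.vandermonde v).det := by
    rw [Matrix.det_eval_matrixOfPolynomials_eq_det_vandermonde v
      (fun i : Fin N => krawtchoukPoly p L i) (fun i => natDegree_krawtchoukPoly p L i)
      (fun i => krawtchoukPoly_monic p L i), ← Matrix.det_transpose]
    rfl
  have hdet : (Matrix.of fun i j : Fin N => krawtchoukONB p L i (f j)).det =
      (∏ i : Fin N, (√(krawtchoukNormSq p L i))⁻¹) *
        ((∏ j, √(krawtchoukWeight p L (f j))) * V.det) := by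
    rw [← Matrix.det_mul_row, ← Matrix.det_mul_column]
    congr 1
    ext i j
    simp only [Matrix.of_apply, krawtchoukONB, krawtchoukFun, sqrtWeight_natCast, V, v,
      Int.cast_natCast]
    ring
  have hnorm : (∏ i : Fin N, krawtchoukNormSq p L i) *
      (∏ i : Fin N, (√(krawtchoukNormSq p L i))⁻¹) ^ 2 = 1 := by
    rw [← Finset.prod_pow, ← Finset.prod_mul_distrib]
    refine Finset.prod_eq_one fun i _ => ?_
    have hpos := krawtchoukNormSq_pos hp (show (i : ℕ) ≤ L by omega)
    rw [inv_pow, Real.sq_sqrt hpos.le, mul_inv_cancel₀ hpos.ne']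
  have hweight : (∏ j, √(krawtchoukWeight p L (f j))) ^ 2 =
      ∏ x ∈ Finset.univ.image f, krawtchoukWeight p L x := by
    rw [← Finset.prod_pow, Finset.prod_image fun _ _ _ _ h => hf h]
    exact Finset.prod_congr rfl fun j _ =>
      Real.sq_sqrt (krawtchoukWeight_pos hp (hfL j)).le
  have hvdm : V.det ^ 2 = ∏ x ∈ Finset.univ.image f, ∏ y ∈ Finset.univ.image f with x < y,
      ((x : ℝ) - (y : ℝ)) ^ 2 := by
    have h1 : V.det ^ 2 = ∏ i : Fin N, ∏ j : Fin N with i < j, |v i - v j| ^ 2 := by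
      rw [hV, Matrix.det_vandermonde, ← Finset.prod_pow]
      refine Finset.prod_congr rfl fun i _ => ?_
      rw [← Finset.prod_pow, show Finset.Ioi i = Finset.univ.filter (i < ·) by ext; simp]
      exact Finset.prod_congr rfl fun j _ => by rw [sq_abs]; ring
    rw [h1, prod_prod_lt_sq_eq Finset.univ (fun i j => |v i - v j|) fun i j => abs_sub_comm _ _]
    simp only [← sq_abs (((_ : ℕ) : ℝ) - _)]
    rw [prod_prod_lt_sq_eq (Finset.univ.image f) (fun x y => |(x : ℝ) - y|)
      fun x y => abs_sub_comm _ _, Finset.prod_image fun _ _ _ _ h => hf h]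
    refine Finset.prod_congr rfl fun i _ => ?_
    rw [Finset.prod_filter, Finset.prod_filter, Finset.prod_image fun _ _ _ _ h => hf h]
    exact Finset.prod_congr rfl fun j _ => if_congr hf.ne_iff.symm rfl rfl
  rw [krawtchoukEnsembleWeight, hdet, ← hweight, ← hvdm]
  linear_combination -((∏ j, √(krawtchoukWeight p L (f j))) ^ 2 * V.det ^ 2) * hnorm

theorem correlation_krawtchoukEnsemble_eq_sum (p : ℝ) (hp : p ∈ Set.Ioo (0 : ℝ) 1) {L N n : ℕ}
    (hN : N ≤ L + 1) (y : Fin n → ℕ) :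
    correlation (krawtchoukEnsemble p hp L N hN) (fun k => (y k : ℤ)) =
      ∑ S ∈ particleConfs L N with ∀ k, y k ∈ S, krawtchoukEnsembleProb p L N S := by
  have hnn : ∀ S ∈ particleConfs L N, 0 ≤ krawtchoukEnsembleProb p L N S := fun S hS =>
    div_nonneg (krawtchoukEnsembleWeight_pos hp.1 hp.2 hS).le
      (Finset.sum_nonneg fun T hT => (krawtchoukEnsembleWeight_pos hp.1 hp.2 hT).le)
  have hmem : ∀ S : Finset ℕ, toConf S ∈ {C : Conf ℤ | ∀ k, C (y k : ℤ) = true} ↔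
      ∀ k, y k ∈ S := fun S => by
    simp [toConf]
  have hreal : (krawtchoukMeasure p L N).real {C : Conf ℤ | ∀ k, C (y k : ℤ) = true} =
      ∑ S ∈ particleConfs L N, if ∀ k, y k ∈ S then krawtchoukEnsembleProb p L N S else 0 := by
    rw [measureReal_def, krawtchoukMeasure, Measure.coe_finsetSum, Finset.sum_apply,
      ENNReal.toReal_sum fun S _ => by
        rw [Measure.smul_apply]; exact ENNReal.mul_ne_top ENNReal.ofReal_ne_top (measure_ne_top _ _)]
    refine Finset.sum_congr rfl fun S hS => ?_
    rw [Measure.smul_apply, Measure.dirac_apply' _ (measurableSet_forall_eq_true _)]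
    by_cases h : ∀ k, y k ∈ S
    · rw [if_pos h, Set.indicator_of_mem ((hmem S).2 h)]
      simp [ENNReal.toReal_ofReal (hnn S hS)]
    · rw [if_neg h, Set.indicator_of_notMem fun h' => h ((hmem S).1 h')]
      simp
  rw [Finset.sum_filter, ← hreal]
  rfl

/-- The Krawtchouk ensemble is determinantal, with the projection kernel onto the span of the first
`N` Krawtchouk functions (the Christoffel–Darboux kernel). -/
theorem correlation_krawtchoukEnsemble {p : ℝ} (hp : p ∈ Set.Ioo (0 : ℝ) 1) {L N n : ℕ}
    (hN : N ≤ L + 1) (y : Fin n → ℤ) (hy : Function.Injective y)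
    (hyL : ∀ k, 0 ≤ y k ∧ y k ≤ L) :
    correlation (krawtchoukEnsemble p hp L N hN) y =
      (Matrix.of fun k l => ∑ i ∈ Finset.range N,
        krawtchoukONB p L i (y k) * krawtchoukONB p L i (y l)).det := by
  obtain ⟨z, rfl⟩ : ∃ z : Fin n → ℕ, y = fun k => (z k : ℤ) :=
    ⟨fun k => (y k).toNat, funext fun k => (Int.toNat_of_nonneg (hyL k).1).symm⟩
  have hz : Function.Injective z := fun k l h => hy (by simp [h])
  have hzA : ∀ k, z k ∈ Finset.range (L + 1) := fun k =>
    Finset.mem_range.2 (by have : (z k : ℤ) ≤ L := (hyL k).2; omega)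
  have h := sum_weight_div_sum_weight (Finset.range (L + 1))
    (fun (i : Fin N) (x : ℕ) => krawtchoukONB p L i (x : ℤ))
    (fun i j => by
      rw [sum_krawtchoukONB_mul hp (by omega)]
      simp [Fin.ext_iff])
    (krawtchoukEnsembleWeight p L) (κ := ∏ i : Fin N, krawtchoukNormSq p L i)
    (Finset.prod_ne_zero_iff.2 fun i _ => (krawtchoukNormSq_pos hp (by omega)).ne')
    (fun f hfA hf => krawtchoukEnsembleWeight_image hp hN f
      (fun i => Nat.lt_succ_iff.1 (Finset.mem_range.1 (hfA i))) hf) z hz hzA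
  rw [correlation_krawtchoukEnsemble_eq_sum]
  simp only [krawtchoukEnsembleProb, ← Finset.sum_div, particleConfs]
  rw [h]
  congr 1
  ext k l
  exact Fin.sum_univ_eq_sum_range
    (fun i => krawtchoukONB p L i (z k : ℤ) * krawtchoukONB p L i (z l : ℤ)) N

/-! ### Functions of a translation-invariant Jacobi operator -/

/-- The matrix entry `g (J) (x, y)`, `m = x - y`, of a function `g` of the translation-invariant
Jacobi operator `J` with entries `A` off the diagonal and `B` on it: the Fourier transform
diagonalizes `J` into the multiplication by `2 A cos θ + B`. -/
def toeplitzEntry (A B : ℝ) (g : ℝ → ℝ) (m : ℤ) : ℝ :=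
  (∫ θ in (0 : ℝ)..Real.pi, g (2 * A * Real.cos θ + B) * Real.cos (m * θ)) / Real.pi

theorem continuous_symbol (A B : ℝ) : Continuous fun θ : ℝ => 2 * A * Real.cos θ + B := by
  fun_prop

theorem intervalIntegrable_toeplitz (A B : ℝ) {g : ℝ → ℝ} (hg : Continuous g) (m : ℤ) :
    IntervalIntegrable (fun θ => g (2 * A * Real.cos θ + B) * Real.cos (m * θ)) volume 0
      Real.pi :=
  Continuous.intervalIntegrable (by fun_prop) _ _

theorem integral_cos_int_mul (m : ℤ) (hm : m ≠ 0) (φ : ℝ) :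
    ∫ θ in (0 : ℝ)..φ, Real.cos (m * θ) = Real.sin (m * φ) / m := by
  have hm' : (m : ℝ) ≠ 0 := by exact_mod_cast hm
  rw [intervalIntegral.integral_comp_mul_left _ hm', integral_cos]
  simp [div_eq_inv_mul]

theorem toeplitzEntry_one (A B : ℝ) (m : ℤ) :
    toeplitzEntry A B (fun _ => 1) m = if m = 0 then 1 else 0 := by
  unfold toeplitzEntry
  simp only [one_mul]
  split_ifs with h
  · simp [h, Real.pi_ne_zero]
  · rw [integral_cos_int_mul m h, Real.sin_int_mul_pi]
    simp

theorem toeplitzEntry_mul_id (A B : ℝ) {g : ℝ → ℝ} (hg : Continuous g) (m : ℤ) :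
    toeplitzEntry A B (fun t => t * g t) m =
      A * toeplitzEntry A B g (m + 1) + B * toeplitzEntry A B g m +
        A * toeplitzEntry A B g (m - 1) := by
  unfold toeplitzEntry
  rw [← mul_div_assoc, ← mul_div_assoc, ← mul_div_assoc, ← add_div, ← add_div,
    ← intervalIntegral.integral_const_mul, ← intervalIntegral.integral_const_mul,
    ← intervalIntegral.integral_const_mul, ← intervalIntegral.integral_add,
    ← intervalIntegral.integral_add]
  · congr 1
    refine intervalIntegral.integral_congr fun θ _ => ?_
    simp only
    push_cast
    rw [show ((m : ℝ) + 1) * θ = m * θ + θ by ring, show ((m : ℝ) - 1) * θ = m * θ - θ by ring,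
      Real.cos_add, Real.cos_sub]
    ring
  all_goals
    first
    | exact (intervalIntegrable_toeplitz A B hg _).const_mul _
    | exact ((intervalIntegrable_toeplitz A B hg _).const_mul _).add
        ((intervalIntegrable_toeplitz A B hg _).const_mul _)

theorem toeplitzEntry_add (A B : ℝ) {g h : ℝ → ℝ} (hg : Continuous g) (hh : Continuous h)
    (m : ℤ) : toeplitzEntry A B (fun t => g t + h t) m =
      toeplitzEntry A B g m + toeplitzEntry A B h m := by
  unfold toeplitzEntry
  rw [← add_div, ← intervalIntegral.integral_add (intervalIntegrable_toeplitz A B hg m)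
    (intervalIntegrable_toeplitz A B hh m)]
  simp only [add_mul]

theorem toeplitzEntry_const_mul (A B c : ℝ) (g : ℝ → ℝ) (m : ℤ) :
    toeplitzEntry A B (fun t => c * g t) m = c * toeplitzEntry A B g m := by
  unfold toeplitzEntry
  rw [← mul_div_assoc, ← intervalIntegral.integral_const_mul]
  simp only [mul_assoc]

/-! ### Convergence of spectral projections -/

section

/-- A sequence of Jacobi operators on `ℤ` with finitely many eigenfunctions `v N n` and
eigenvalues `μ N n`, `n ∈ I N`. The eigenvalues lie in `[-1, 1]`, the eigenfunctions resolve
the identity at any given site for large `N`, and the entries converge to constants `A`, `B`. -/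
structure JacobiApprox (I : ℕ → Finset ℕ) (v : ℕ → ℕ → ℤ → ℝ) (μ : ℕ → ℕ → ℝ)
    (α β : ℕ → ℤ → ℝ) (A B : ℝ) : Prop where
  eigen : ∀ᶠ N in atTop, ∀ n ∈ I N, ∀ x, jacobi (α N) (β N) (v N n) x = μ N n * v N n x
  resolve : ∀ y, ∀ᶠ N in atTop, ∀ x, ∑ n ∈ I N, v N n x * v N n y = if x = y then 1 else 0
  mem_Icc : ∀ᶠ N in atTop, ∀ n ∈ I N, μ N n ∈ Set.Icc (-1 : ℝ) 1
  tendsto_offDiag : ∀ x, Tendsto (fun N => α N x) atTop (𝓝 A)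
  tendsto_diag : ∀ x, Tendsto (fun N => β N x) atTop (𝓝 B)

variable {I : ℕ → Finset ℕ} {v : ℕ → ℕ → ℤ → ℝ} {μ : ℕ → ℕ → ℝ} {α β : ℕ → ℤ → ℝ} {A B : ℝ}

/-- The moments of the operators converge, as the entry `(x, y)` of a power of a tridiagonal
operator involves finitely many entries only. -/
theorem JacobiApprox.tendsto_moment (h : JacobiApprox I v μ α β A B) (k : ℕ) (x y : ℤ) :
    Tendsto (fun N => ∑ n ∈ I N, μ N n ^ k * (v N n x * v N n y)) atTop
      (𝓝 (toeplitzEntry A B (fun t => t ^ k) (x - y))) := by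
  induction k generalizing x with
  | zero =>
    simp only [pow_zero, one_mul, toeplitzEntry_one, sub_eq_zero]
    exact tendsto_const_nhds.congr' ((h.resolve y).mono fun N hN => (hN x).symm)
  | succ k ih =>
    simp only [pow_succ']
    rw [toeplitzEntry_mul_id A B (continuous_pow k)]
    have h1 := (((h.tendsto_offDiag x).mul (ih (x + 1))).add ((h.tendsto_diag x).mul (ih x))).add
      ((h.tendsto_offDiag (x - 1)).mul (ih (x - 1)))
    rw [show x + 1 - y = x - y + 1 by ring, show x - 1 - y = x - y - 1 by ring] at h1
    refine h1.congr' (h.eigen.mono fun N hN => ?_)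
    rw [Finset.mul_sum, Finset.mul_sum, Finset.mul_sum, ← Finset.sum_add_distrib,
      ← Finset.sum_add_distrib]
    refine Finset.sum_congr rfl fun n hn => ?_
    have h2 := hN n hn x
    rw [jacobi] at h2
    linear_combination μ N n ^ k * v N n y * h2

theorem JacobiApprox.tendsto_polynomial (h : JacobiApprox I v μ α β A B) (P : ℝ[X]) (x y : ℤ) :
    Tendsto (fun N => ∑ n ∈ I N, P.eval (μ N n) * (v N n x * v N n y)) atTop
      (𝓝 (toeplitzEntry A B (fun t => P.eval t) (x - y))) := by
  induction P using Polynomial.induction_on' with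
  | add P Q hP hQ =>
    simp only [eval_add, add_mul, Finset.sum_add_distrib]
    rw [toeplitzEntry_add A B P.continuous Q.continuous]
    exact hP.add hQ
  | monomial k a =>
    simp only [eval_monomial, mul_assoc, ← Finset.mul_sum]
    rw [toeplitzEntry_const_mul]
    exact (h.tendsto_moment k x y).const_mul a

/-- The indicator of `(0, ∞)`. -/
def posInd (t : ℝ) : ℝ := if 0 < t then 1 else 0

theorem measurable_posInd : Measurable posInd :=
  Measurable.ite measurableSet_Ioi measurable_const measurable_const

/-- The piecewise linear tent `max (0, 1 - k |t|)`. -/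
def tent (k : ℕ) (t : ℝ) : ℝ := max 0 (1 - k * |t|)

/-- The piecewise linear approximation to the indicator of `(0, ∞)`. -/
def ramp (k : ℕ) (t : ℝ) : ℝ := max 0 (min 1 (k * t))

theorem abs_posInd_sub_ramp_le (k : ℕ) (t : ℝ) : |posInd t - ramp k t| ≤ tent k t := by
  have hk : (0 : ℝ) ≤ k := k.cast_nonneg
  unfold posInd ramp tent
  rcases lt_or_ge 0 t with ht | ht
  · rw [if_pos ht, abs_of_pos ht, max_eq_right (le_min zero_le_one (by positivity)),
      abs_of_nonneg (sub_nonneg.2 (min_le_left _ _))]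
    rcases le_total 1 (k * t) with h | h
    · rw [min_eq_left h, sub_self]; exact le_max_left _ _
    · rw [min_eq_right h]; exact le_max_right _ _
  · rw [if_neg ht.not_gt, max_eq_left ((min_le_right _ _).trans (mul_nonpos_of_nonneg_of_nonpos hk ht))]
    simp

theorem tendsto_tent {t : ℝ} (ht : t ≠ 0) : Tendsto (fun k => tent k t) atTop (𝓝 0) := by
  have h : ∀ᶠ k : ℕ in atTop, (0 : ℝ) = tent k t := by
    filter_upwards [(tendsto_natCast_atTop_atTop (R := ℝ)).eventually_ge_atTop (|t|)⁻¹] with k hk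
    have : 1 ≤ (k : ℝ) * |t| := by
      rwa [inv_le_iff_one_le_mul₀ (abs_pos.2 ht)] at hk
    exact (max_eq_left (by linarith)).symm
  exact tendsto_const_nhds.congr' h

theorem continuous_tent (k : ℕ) : Continuous (tent k) := by unfold tent; fun_prop

theorem continuous_ramp (k : ℕ) : Continuous (ramp k) := by unfold ramp; fun_prop

/-- The spectrum of the limit operator has no atom at zero. -/
theorem tendsto_toeplitzEntry_tent (hA : 0 < A) :
    Tendsto (fun k => toeplitzEntry A B (tent k) 0) atTop (𝓝 0) := by
  have h : Tendsto (fun k : ℕ => ∫ θ in (0 : ℝ)..Real.pi,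
      tent k (2 * A * Real.cos θ + B) * Real.cos ((0 : ℤ) * θ)) atTop
      (𝓝 (∫ _θ in (0 : ℝ)..Real.pi, (0 : ℝ))) := by
    refine intervalIntegral.tendsto_integral_filter_of_dominated_convergence (fun _ => 1)
      (Eventually.of_forall fun k => ?_) (Eventually.of_forall fun k => ?_)
      intervalIntegrable_const ?_
    · have := continuous_tent k
      exact Continuous.aestronglyMeasurable (by fun_prop)
    · refine Eventually.of_forall fun θ _ => ?_
      have h1 : (0 : ℝ) ≤ k * |2 * A * Real.cos θ + B| := by positivity
      simp only [Int.cast_zero, zero_mul, Real.cos_zero, mul_one, tent, Real.norm_eq_abs]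
      rw [abs_of_nonneg (le_max_left _ _)]
      exact max_le zero_le_one (by linarith)
    · have hnull : ∀ᵐ θ : ℝ, θ ≠ Real.arccos (-B / (2 * A)) := by
        simp [ae_iff, measure_singleton]
      refine hnull.mono fun θ hθ hmem => ?_
      rw [Set.uIoc_of_le Real.pi_pos.le] at hmem
      have hne : 2 * A * Real.cos θ + B ≠ 0 := fun h0 => hθ <| by
        rw [← Real.arccos_cos hmem.1.le hmem.2]
        congr 1
        field_simp
        linarith
      simpa using tendsto_tent hne
  simpa [toeplitzEntry] using h.div_const Real.pi

theorem intervalIntegrable_toeplitz_posInd (A B : ℝ) (m : ℤ) (a b : ℝ) :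
    IntervalIntegrable (fun θ => posInd (2 * A * Real.cos θ + B) * Real.cos (m * θ)) volume a b := by
  refine (intervalIntegrable_const (c := (1 : ℝ))).mono_fun
    (Measurable.aestronglyMeasurable
      ((measurable_posInd.comp (continuous_symbol A B).measurable).mul
        (Continuous.measurable (by fun_prop)))) (Eventually.of_forall fun θ => ?_)
  have h1 : |posInd (2 * A * Real.cos θ + B)| ≤ 1 := by unfold posInd; split_ifs <;> simp
  simp only [norm_mul, Real.norm_eq_abs, abs_one]
  exact mul_le_one₀ h1 (abs_nonneg _) (Real.abs_cos_le_one _)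

theorem abs_toeplitzEntry_sub_le (hspec : ∀ θ, 2 * A * Real.cos θ + B ∈ Set.Icc (-1 : ℝ) 1)
    {g₁ g₂ h : ℝ → ℝ} {m : ℤ}
    (hg₁ : IntervalIntegrable (fun θ => g₁ (2 * A * Real.cos θ + B) * Real.cos (m * θ)) volume 0
      Real.pi)
    (hg₂ : IntervalIntegrable (fun θ => g₂ (2 * A * Real.cos θ + B) * Real.cos (m * θ)) volume 0
      Real.pi)
    (hh : Continuous h) (hle : ∀ t ∈ Set.Icc (-1 : ℝ) 1, |g₁ t - g₂ t| ≤ h t) :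
    |toeplitzEntry A B g₁ m - toeplitzEntry A B g₂ m| ≤ toeplitzEntry A B h 0 := by
  unfold toeplitzEntry
  rw [← sub_div, ← intervalIntegral.integral_sub hg₁ hg₂, abs_div, abs_of_pos Real.pi_pos,
    ← Real.norm_eq_abs]
  refine div_le_div_of_nonneg_right ?_ Real.pi_pos.le
  refine intervalIntegral.norm_integral_le_of_norm_le Real.pi_pos.le
    (Eventually.of_forall fun θ _ => ?_) (intervalIntegrable_toeplitz A B hh 0)
  rw [← sub_mul, norm_mul, Real.norm_eq_abs, Real.norm_eq_abs, Int.cast_zero, zero_mul,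
    Real.cos_zero]
  have h1 := hle _ (hspec θ)
  exact mul_le_mul h1 (Real.abs_cos_le_one _) (abs_nonneg _) ((abs_nonneg _).trans h1)

/-- Weierstrass approximation of the indicator of `(0, ∞)` on `[-1, 1]` by a polynomial, with the
error dominated by a polynomial whose mean with respect to the spectral measure of the limit
operator is small. -/
theorem exists_polynomial_majorant (hA : 0 < A)
    (hspec : ∀ θ, 2 * A * Real.cos θ + B ∈ Set.Icc (-1 : ℝ) 1) {ε : ℝ} (hε : 0 < ε) :
    ∃ P H : ℝ[X], (∀ t ∈ Set.Icc (-1 : ℝ) 1, |posInd t - P.eval t| ≤ H.eval t) ∧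
      toeplitzEntry A B (fun t => H.eval t) 0 < ε := by
  obtain ⟨k, hk⟩ := ((tendsto_toeplitzEntry_tent (B := B) hA).eventually_lt_const
    (show 0 < ε / 4 by positivity)).exists
  obtain ⟨P, hP⟩ := exists_polynomial_near_of_continuousOn (-1) 1 (ramp k)
    (continuous_ramp k).continuousOn (ε / 8) (by positivity)
  obtain ⟨H, hH⟩ := exists_polynomial_near_of_continuousOn (-1) 1 (tent k)
    (continuous_tent k).continuousOn (ε / 8) (by positivity)
  refine ⟨P, H + C (ε / 4), fun t ht => ?_, ?_⟩
  · have h1 := abs_posInd_sub_ramp_le k t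
    have h2 := hP t ht
    have h3 := (abs_lt.1 (hH t ht)).1
    have h4 := abs_sub_le (posInd t) (ramp k t) (P.eval t)
    rw [abs_sub_comm (ramp k t)] at h4
    rw [eval_add, eval_C]
    linarith
  · have h1 := abs_toeplitzEntry_sub_le hspec (g₁ := fun t => (H + C (ε / 4)).eval t)
      (intervalIntegrable_toeplitz A B (H + C (ε / 4)).continuous 0)
      (intervalIntegrable_toeplitz A B (continuous_tent k) 0)
      (h := fun _ => 3 * ε / 8 * 1) continuous_const fun t ht => by
        have h3 := abs_lt.1 (hH t ht)
        rw [eval_add, eval_C, abs_le]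
        constructor <;> linarith
    rw [toeplitzEntry_const_mul A B (3 * ε / 8) (fun _ => 1), toeplitzEntry_one, if_pos rfl] at h1
    have h2 := (abs_le.1 h1).2
    linarith

/-- The spectral projections onto `(0, ∞)` converge entrywise. A polynomial `P` replaces the
indicator at the cost of the quadratic form of a majorant `H`, whose diagonal entries converge to a
small limit and control the entry `(x, y)` by `|v x * v y| ≤ (v x ^ 2 + v y ^ 2) / 2`. -/
theorem JacobiApprox.tendsto_spectralProjection (h : JacobiApprox I v μ α β A B) (hA : 0 < A)
    (hspec : ∀ θ, 2 * A * Real.cos θ + B ∈ Set.Icc (-1 : ℝ) 1) (x y : ℤ) :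
    Tendsto (fun N => ∑ n ∈ I N, posInd (μ N n) * (v N n x * v N n y)) atTop
      (𝓝 (toeplitzEntry A B posInd (x - y))) := by
  rw [Metric.tendsto_nhds]
  intro ε hε
  obtain ⟨P, H, hPH, hH⟩ := exists_polynomial_majorant hA hspec (show 0 < ε / 4 by positivity)
  have hx := h.tendsto_polynomial H x x
  have hy := h.tendsto_polynomial H y y
  rw [sub_self] at hx hy
  have hlim := abs_toeplitzEntry_sub_le hspec
    (intervalIntegrable_toeplitz_posInd A B (x - y) 0 Real.pi)
    (intervalIntegrable_toeplitz A B P.continuous (x - y)) H.continuous hPH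
  filter_upwards [hx.eventually_lt_const hH, hy.eventually_lt_const hH, h.mem_Icc,
    (Metric.tendsto_nhds.1 (h.tendsto_polynomial P x y)) (ε / 4) (by positivity)]
    with N h1 h2 h3 h4
  have h5 : |∑ n ∈ I N, posInd (μ N n) * (v N n x * v N n y) -
      ∑ n ∈ I N, P.eval (μ N n) * (v N n x * v N n y)| ≤
      ((∑ n ∈ I N, H.eval (μ N n) * (v N n x * v N n x)) +
        ∑ n ∈ I N, H.eval (μ N n) * (v N n y * v N n y)) / 2 := by
    rw [← Finset.sum_sub_distrib, ← Finset.sum_add_distrib, Finset.sum_div]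
    refine (Finset.abs_sum_le_sum_abs _ _).trans (Finset.sum_le_sum fun n hn => ?_)
    have h6 := hPH _ (h3 n hn)
    have h7 : |v N n x * v N n y| ≤ (v N n x * v N n x + v N n y * v N n y) / 2 := by
      rw [abs_le]
      constructor <;> nlinarith [sq_nonneg (v N n x + v N n y), sq_nonneg (v N n x - v N n y)]
    rw [← sub_mul, abs_mul, ← mul_add, mul_div_assoc]
    exact mul_le_mul h6 h7 (abs_nonneg _) ((abs_nonneg _).trans h6)
  rw [Real.dist_eq] at h4 ⊢
  have h8 := abs_le.1 h5
  have h9 := abs_lt.1 h4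
  have h10 := abs_le.1 hlim
  rw [abs_lt]
  constructor <;> linarith

/-- The positive spectral projection of the limit operator is the discrete sine kernel: the symbol
`2 A cos θ + B` is positive on `[0, π]` precisely for `θ < arccos (-B / 2A)`. -/
theorem toeplitzEntry_posInd (hA : 0 < A) (hB : |B| ≤ 2 * A) (x y : ℤ) :
    toeplitzEntry A B posInd (x - y) =
      discreteSineKernel (Real.arccos (-B / (2 * A))) x y := by
  set φ := Real.arccos (-B / (2 * A)) with hφ
  have hB' := abs_le.1 hB
  have hcos : Real.cos φ = -B / (2 * A) :=
    Real.cos_arccos (by rw [le_div_iff₀ (by positivity)]; linarith)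
      (by rw [div_le_iff₀ (by positivity)]; linarith)
  have h0 : 0 ≤ φ := Real.arccos_nonneg _
  have hπ : φ ≤ Real.pi := Real.arccos_le_pi _
  have hpos : ∀ θ ∈ Set.Icc 0 Real.pi, posInd (2 * A * Real.cos θ + B) = if θ < φ then 1 else 0 :=
    fun θ hθ => by
      refine if_congr ?_ rfl rfl
      rw [← Real.strictAntiOn_cos.lt_iff_gt ⟨h0, hπ⟩ hθ, hcos, div_lt_iff₀ (by positivity)]
      constructor <;> intro h <;> linarith
  have hint : ∫ θ in (0 : ℝ)..Real.pi, posInd (2 * A * Real.cos θ + B) *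
      Real.cos ((x - y : ℤ) * θ) = ∫ θ in (0 : ℝ)..φ, Real.cos ((x - y : ℤ) * θ) := by
    rw [← intervalIntegral.integral_add_adjacent_intervals
      (intervalIntegrable_toeplitz_posInd A B (x - y) 0 φ)
      (intervalIntegrable_toeplitz_posInd A B (x - y) φ Real.pi)]
    have h2 : ∫ θ in φ..Real.pi, posInd (2 * A * Real.cos θ + B) *
        Real.cos ((x - y : ℤ) * θ) = ∫ _θ in φ..Real.pi, (0 : ℝ) := by
      refine intervalIntegral.integral_congr fun θ hθ => ?_
      rw [Set.uIcc_of_le hπ] at hθ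
      rw [hpos θ ⟨h0.trans hθ.1, hθ.2⟩, if_neg hθ.1.not_gt, zero_mul]
    have h3 : ∫ θ in (0 : ℝ)..φ, posInd (2 * A * Real.cos θ + B) *
        Real.cos ((x - y : ℤ) * θ) = ∫ θ in (0 : ℝ)..φ, Real.cos ((x - y : ℤ) * θ) := by
      have hnull : ∀ᵐ θ : ℝ, θ ≠ φ := by simp [ae_iff, measure_singleton]
      refine intervalIntegral.integral_congr_ae (hnull.mono fun θ hθ hmem => ?_)
      rw [Set.uIoc_of_le h0] at hmem
      rw [hpos θ ⟨hmem.1.le, hmem.2.trans hπ⟩, if_pos (lt_of_le_of_ne hmem.2 hθ), one_mul]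
    rw [h2, h3, intervalIntegral.integral_zero, add_zero]
  rw [toeplitzEntry, hint, discreteSineKernel]
  split_ifs with hxy
  · simp [hxy]
  · rw [integral_cos_int_mul _ (sub_ne_zero.2 hxy), div_div]
    push_cast
    rw [mul_comm φ, mul_comm Real.pi]

end

/-! ### The scaling limit of the Krawtchouk kernel -/

/-- The symbol of the limit operator takes values in `[-1, 1]`, by the Cauchy–Schwarz inequality
for the unit vectors `(2 √(p (1 - p)), 1 - 2 p)` and `(√(1 - c²), -c)`. -/
theorem krawtchouk_symbol_mem_Icc {p c : ℝ} (hp : p ∈ Set.Ioo (0 : ℝ) 1) (hc : c ^ 2 ≤ 1) (θ : ℝ) :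
    2 * √((1 - c ^ 2) * p * (1 - p)) * Real.cos θ + -((1 - 2 * p) * c) ∈ Set.Icc (-1 : ℝ) 1 := by
  have hpq : 0 ≤ p * (1 - p) := mul_nonneg hp.1.le (by linarith [hp.2])
  rw [mul_assoc (1 - c ^ 2), Real.sqrt_mul (by linarith)]
  have hs := Real.sq_sqrt hpq
  have hr := Real.sq_sqrt (show 0 ≤ 1 - c ^ 2 by linarith)
  set s := √(p * (1 - p))
  set r := √(1 - c ^ 2)
  set t := Real.cos θ
  have ht1 : t ^ 2 ≤ 1 := Real.cos_sq_le_one θ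
  rw [Set.mem_Icc, ← abs_le]
  refine abs_le_one_iff_mul_self_le_one.2 ?_
  have h1 : 4 * s ^ 2 + (1 - 2 * p) ^ 2 = 1 := by rw [hs]; ring
  have h2 : r ^ 2 * t ^ 2 + c ^ 2 ≤ 1 := by nlinarith [sq_nonneg r]
  have h3 : (2 * (r * s) * t + -((1 - 2 * p) * c)) ^ 2 +
      (2 * s * c + (1 - 2 * p) * r * t) ^ 2 = r ^ 2 * t ^ 2 + c ^ 2 := by
    linear_combination (r ^ 2 * t ^ 2 + c ^ 2) * h1
  nlinarith [sq_nonneg (2 * s * c + (1 - 2 * p) * r * t)]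

theorem tendsto_krawtchouk_arguments {c : ℝ} {a : ℕ → ℤ}
    (ha : Tendsto (fun N : ℕ => (a N : ℝ) / (N : ℝ)) atTop (𝓝 c)) (x : ℤ) :
    Tendsto (fun N : ℕ => (((x + (N + a N) : ℤ) : ℝ) + 1) / N) atTop (𝓝 (1 + c)) ∧
      Tendsto (fun N : ℕ => (((2 * N - 1 : ℕ) : ℝ) - ((x + (N + a N) : ℤ) : ℝ)) / N) atTop
        (𝓝 (1 - c)) ∧
      Tendsto (fun N : ℕ => (((2 * N - 1 : ℕ) : ℝ) / 2 - ((x + (N + a N) : ℤ) : ℝ)) / N) atTop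
        (𝓝 (-c)) := by
  have hconst : ∀ r : ℝ, Tendsto (fun N : ℕ => r / (N : ℝ)) atTop (𝓝 0) := fun r =>
    tendsto_const_div_atTop_nhds_zero_nat r
  have hL : ∀ N : ℕ, 1 ≤ N → ((2 * N - 1 : ℕ) : ℝ) = 2 * N - 1 := fun N hN => by
    rw [Nat.cast_sub (by omega)]; push_cast; ring
  refine ⟨?_, ?_, ?_⟩
  · have h := (tendsto_const_nhds (x := (1 : ℝ))).add (ha.add (hconst (x + 1)))
    rw [add_zero] at h
    refine h.congr' ((eventually_ge_atTop 1).mono fun N hN => ?_)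
    have hN' : (N : ℝ) ≠ 0 := by positivity
    push_cast
    field_simp
    ring
  · have h := (tendsto_const_nhds (x := (1 : ℝ))).sub (ha.add (hconst (x + 1)))
    rw [add_zero] at h
    refine h.congr' ((eventually_ge_atTop 1).mono fun N hN => ?_)
    have hN' : (N : ℝ) ≠ 0 := by positivity
    simp only [hL N hN]
    push_cast
    field_simp
    ring
  · have h := (ha.add (hconst (x + 1 / 2))).neg
    rw [add_zero] at h
    refine h.congr' ((eventually_ge_atTop 1).mono fun N hN => ?_)
    have hN' : (N : ℝ) ≠ 0 := by positivity
    simp only [hL N hN]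
    push_cast
    field_simp
    ring

/-- Any given site of the shifted lattice lies in the support of the ensemble for large `N`. -/
theorem eventually_mem_support {c : ℝ} (hc : |c| < 1) {a : ℕ → ℤ}
    (ha : Tendsto (fun N : ℕ => (a N : ℝ) / (N : ℝ)) atTop (𝓝 c)) (x : ℤ) :
    ∀ᶠ N : ℕ in atTop, 0 ≤ x + (N + a N) ∧ x + (N + a N) ≤ (2 * N - 1 : ℕ) := by
  obtain ⟨h1, h2, -⟩ := tendsto_krawtchouk_arguments ha x
  rw [abs_lt] at hc
  filter_upwards [h1.eventually_const_lt (show 0 < 1 + c by linarith),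
    h2.eventually_const_lt (show 0 < 1 - c by linarith), eventually_ge_atTop 1] with N h3 h4 hN
  have hN' : (0 : ℝ) < N := by positivity
  rw [div_pos_iff_of_pos_right hN'] at h3 h4
  have h5 : (0 : ℤ) < x + (N + a N) + 1 := by exact_mod_cast h3
  have h6 : x + (N + a N) < (2 * N - 1 : ℕ) := by
    have := sub_pos.1 h4
    exact_mod_cast this
  omega

/-- The symmetrized Krawtchouk operators, divided by `N` and seen from the site `N + a N`,
converge to a translation-invariant operator. -/
theorem jacobiApprox_krawtchouk {p c : ℝ} (hp : p ∈ Set.Ioo (0 : ℝ) 1) (hc : |c| < 1)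
    {a : ℕ → ℤ} (ha : Tendsto (fun N : ℕ => (a N : ℝ) / (N : ℝ)) atTop (𝓝 c)) :
    JacobiApprox (fun N => Finset.range (2 * N - 1 + 1))
      (fun N n x => krawtchoukONB p (2 * N - 1) n (x + (N + a N)))
      (fun N n => (((2 * N - 1 : ℕ) : ℝ) / 2 - n) / N)
      (fun N x => krawtchoukOffDiag p (2 * N - 1) (x + (N + a N)) / N)
      (fun N x => krawtchoukDiag p (2 * N - 1) (x + (N + a N)) / N)
      (√((1 - c ^ 2) * p * (1 - p))) (-((1 - 2 * p) * c)) where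
  eigen := Eventually.of_forall fun N n _ x => by
    have h := jacobi_krawtchoukONB hp (2 * N - 1) n (x + (N + a N))
    simp only [jacobi] at h ⊢
    rw [show x + 1 + (N + a N) = x + (N + a N) + 1 by ring,
      show x - 1 + (N + a N) = x + (N + a N) - 1 by ring, div_mul_eq_mul_div, div_mul_eq_mul_div,
      div_mul_eq_mul_div, div_mul_eq_mul_div, ← add_div, ← add_div, h]
  resolve y := (eventually_mem_support hc ha y).mono fun N hN x => by
    rw [sum_krawtchoukONB_mul_eq hp hN]
    simp
  mem_Icc := (eventually_ge_atTop 1).mono fun N hN n hn => by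
    have hN' : (0 : ℝ) < N := by positivity
    have hn' : (n : ℝ) ≤ (2 * N - 1 : ℕ) := by
      exact_mod_cast Nat.lt_succ_iff.1 (Finset.mem_range.1 hn)
    have hn0 : (0 : ℝ) ≤ n := n.cast_nonneg
    rw [Nat.cast_sub (by omega)] at hn' ⊢
    push_cast at hn' ⊢
    rw [Set.mem_Icc, le_div_iff₀ hN', div_le_iff₀ hN']
    constructor <;> linarith
  tendsto_offDiag x := by
    obtain ⟨h1, h2, -⟩ := tendsto_krawtchouk_arguments ha x
    have h := ((h2.mul h1).const_mul (p * (1 - p))).sqrt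
    rw [show p * (1 - p) * ((1 - c) * (1 + c)) = (1 - c ^ 2) * p * (1 - p) by ring] at h
    refine h.congr' ((eventually_ge_atTop 1).mono fun N hN => ?_)
    have hN' : (0 : ℝ) < N := by positivity
    simp only [krawtchoukOffDiag]
    rw [div_mul_div_comm, ← mul_div_assoc, Real.sqrt_div' _ (by positivity),
      Real.sqrt_mul_self hN'.le]
  tendsto_diag x := by
    obtain ⟨-, -, h3⟩ := tendsto_krawtchouk_arguments ha x
    have h := h3.const_mul (1 - 2 * p)
    rw [mul_neg] at h
    refine h.congr fun N => ?_
    rw [krawtchoukDiag, mul_div_assoc]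

/-- The Christoffel–Darboux kernel converges to the discrete sine kernel. The bound on `c` says that
the symbol of the limit operator changes sign, i.e. `|B| < 2 A`. -/
theorem tendsto_christoffelDarboux {p c : ℝ} (hp : p ∈ Set.Ioo (0 : ℝ) 1)
    (hc : |c| < 2 * Real.sqrt (p * (1 - p)))
    {a : ℕ → ℤ} (ha : Tendsto (fun N : ℕ => (a N : ℝ) / (N : ℝ)) atTop (𝓝 c)) (x y : ℤ) :
    Tendsto (fun N : ℕ => ∑ n ∈ Finset.range N, krawtchoukONB p (2 * N - 1) n (x + (N + a N)) *
        krawtchoukONB p (2 * N - 1) n (y + (N + a N))) atTop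
      (𝓝 (discreteSineKernel
        (Real.arccos (c * (1 - 2 * p) / (2 * Real.sqrt ((1 - c ^ 2) * p * (1 - p))))) x y)) := by
  obtain ⟨hp0, hp1⟩ := id hp
  have hpq : 0 < p * (1 - p) := mul_pos hp0 (by linarith)
  have hc2 : c ^ 2 < 4 * (p * (1 - p)) := by
    have h := sq_lt_sq' (by linarith [abs_nonneg c]) hc
    rw [sq_abs, mul_pow, Real.sq_sqrt hpq.le] at h
    linarith
  have hc1 : c ^ 2 < 1 := by nlinarith [sq_nonneg (2 * p - 1)]
  have hcabs : |c| < 1 := by rwa [← sq_lt_one_iff_abs_lt_one]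
  have hA2 : 0 < (1 - c ^ 2) * p * (1 - p) := by
    rw [mul_assoc]; exact mul_pos (by linarith) hpq
  have hA := Real.sqrt_pos.2 hA2
  have hB : |-((1 - 2 * p) * c)| ≤ 2 * √((1 - c ^ 2) * p * (1 - p)) := by
    refine abs_le_of_sq_le_sq ?_ (by positivity)
    rw [mul_pow, Real.sq_sqrt hA2.le]
    nlinarith
  have h := (jacobiApprox_krawtchouk hp hcabs ha).tendsto_spectralProjection hA
    (krawtchouk_symbol_mem_Icc hp hc1.le) x y
  rw [toeplitzEntry_posInd hA hB, neg_neg, mul_comm (1 - 2 * p)] at h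
  refine h.congr' ((eventually_ge_atTop 1).mono fun N hN => ?_)
  have hN' : (0 : ℝ) < N := by positivity
  -- the eigenvalue `(N - 1/2 - n) / N` is positive exactly for `n < N`
  have hpos : ∀ n : ℕ, posInd ((((2 * N - 1 : ℕ) : ℝ) / 2 - n) / N) = if n < N then 1 else 0 :=
    fun n => by
      refine if_congr ?_ rfl rfl
      rw [div_pos_iff_of_pos_right hN', Nat.cast_sub (by omega)]
      push_cast
      constructor
      · intro h1
        have : (n : ℝ) < N := by linarith
        exact_mod_cast this
      · intro h1
        have : (n : ℝ) + 1 ≤ N := by exact_mod_cast h1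
        linarith
  simp only [hpos, ite_mul, one_mul, zero_mul]
  rw [← Finset.sum_filter]
  congr 1
  ext n
  simp only [Finset.mem_filter, Finset.mem_range]
  omega

end

theorem proposition5p2 (p c : ℝ) (hp : p ∈ Set.Ioo (0 : ℝ) 1)
    (hc : |c| < 2 * Real.sqrt (p * (1 - p)))
    (a : ℕ → ℤ) (ha : Tendsto (fun N : ℕ => (a N : ℝ) / (N : ℝ)) atTop (𝓝 c))
    (φ : ℝ)
    (hφ : φ = Real.arccos (c * (1 - 2 * p) / (2 * Real.sqrt ((1 - c ^ 2) * p * (1 - p))))) :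
    ∃ P : ProbabilityMeasure (Conf ℤ),
      IsDeterminantal P (discreteSineKernel φ) ∧
      (∀ Q : ProbabilityMeasure (Conf ℤ), IsDeterminantal Q (discreteSineKernel φ) → Q = P) ∧
      IsTranslationInvariant P ∧
      Tendsto
        (fun N : ℕ => shiftProcess ((N : ℤ) + a N)
          (krawtchoukEnsemble p hp (2 * N - 1) N (le_two_mul_sub_one_add_one N)))
        atTop (𝓝 P) := by
  subst hφ
  have hc1 : |c| < 1 := by
    have h : Real.sqrt (p * (1 - p)) ≤ 1 / 2 :=
      Real.sqrt_le_iff.2 ⟨by norm_num, by nlinarith [sq_nonneg (2 * p - 1)]⟩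
    linarith
  obtain ⟨P, hP, hlim⟩ := exists_isDeterminantal_of_tendsto_correlation
    (K := discreteSineKernel
      (Real.arccos (c * (1 - 2 * p) / (2 * Real.sqrt ((1 - c ^ 2) * p * (1 - p))))))
    (P := fun N : ℕ => shiftProcess ((N : ℤ) + a N)
      (krawtchoukEnsemble p hp (2 * N - 1) N (le_two_mul_sub_one_add_one N)))
    fun n x hx => by
      have hdet := ((continuous_id (X := Matrix (Fin n) (Fin n) ℝ)).matrix_det.tendsto _).comp
        (tendsto_pi_nhds.2 fun k => tendsto_pi_nhds.2 fun l =>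
          tendsto_christoffelDarboux hp hc ha (x k) (x l))
      refine hdet.congr' ?_
      filter_upwards [eventually_all.2 fun k => eventually_mem_support hc1 ha (x k)] with N hN
      rw [correlation_shiftProcess, correlation_krawtchoukEnsemble hp _
        (fun k => x k + (N + a N)) ((add_left_injective _).comp hx) hN]
      rfl
  exact ⟨P, hP, fun Q hQ => hP.unique hQ,
    hP.isTranslationInvariant (discreteSineKernel_add_right _), hlim⟩
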